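/- Let $E>0$ and $-1<\nu<1$. Let $u:\mathbb{R}\to[0,\infty)$ be continuous with $\{u>0\}=(-1,1)$. Let $(-\Delta)^{1/2}u$ be the tempered distribution with Fourier transform $|k|\,\hat u(k)$, where $\hat u(k)=\int_{\mathbb R}u(x)e^{-ikx}\,dx$. Suppose that $$p=\frac{E}{4(1-\nu^2)}(-\Delta)^{1/2}u ,$$ in the sense that $p:\mathbb{R}\to\mathbb{R}$ is locally integrable on $\mathbb{R}\setminus\{-1,1\}$ and the identity holds as an equality of distributions on $\mathbb{R}\setminus\{-1,1\}$; that $p$ is continuous on $(1,\infty)$ (choice of the representative); and that $\int_{-1}^1\frac{\sqrt{1+z}}{\sqrt{1-z}}\,|p(z)|\,dz<\infty$. Then $$\lim_{x\to1^+}-\sqrt{x-1}\;p(x)=\frac{1}{\pi\sqrt2}\int_{-1}^1\frac{\sqrt{1+z}}{\sqrt{1-z}}\,p(z)\,dz .$$ If moreover $z\mapsto\sqrt{1-z}\,p(z)$ is Hölder continuous (with some positive exponent) on $(x_0,1)$ for some $x_0<1$, then $u$ is differentiable at every $x<1$ close enough to $1$, and $$\lim_{x\to1^-}u'(x)\sqrt{1-x}=-\frac{4(1-\nu^2)}{\pi\sqrt2\,E}\int_{-1}^1\frac{\sqrt{1+z}}{\sqrt{1-z}}\,p(z)\,dz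 .$$ -/

import Mathlib

open Set Filter Topology MeasureTheory
open scoped SchwartzMap FourierTransform NNReal

noncomputable section

/-- The tempered distribution `(-Δ)^{1/2} u` on the line, for a function `u : ℝ → ℝ` (continuous
with compact support in all uses), evaluated at a Schwartz function `φ`.  It is the distribution
whose Fourier transform is the function `k ↦ |k| û(k)`, where `û(k) = ∫ u(x) e^{-ikx} dx`.
Mathlib's transform is `𝓕 u ξ = ∫ u(x) e^{-2πixξ} dx = û(2πξ)`, so that in Mathlib's variable
the symbol `|k|` reads `2π|ξ|`; and `T φ = (𝓕 T) (𝓕⁻ φ)` for a tempered distribution `T`. -/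
def halfLaplacian (u : ℝ → ℝ) (φ : 𝓢(ℝ, ℂ)) : ℂ :=
  ∫ ξ : ℝ, ((2 * Real.pi * |ξ| : ℝ) : ℂ) * 𝓕 (fun x : ℝ => (u x : ℂ)) ξ *
    (𝓕⁻ φ : 𝓢(ℝ, ℂ)) ξ

/-- The pressure law `p = E / (4 (1 - ν²)) (-Δ)^{1/2} u` for a fracture with tips `-1` and `1`:
away from the two tips, where `p` may be singular, the distribution
`E / (4 (1 - ν²)) (-Δ)^{1/2} u` is the locally integrable function `p`. -/
def PressureLaw (E ν : ℝ) (u p : ℝ → ℝ) : Prop :=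
  LocallyIntegrableOn p ({-1, 1}ᶜ : Set ℝ) ∧
  ∀ φ : 𝓢(ℝ, ℂ), HasCompactSupport φ → tsupport φ ⊆ ({-1, 1}ᶜ : Set ℝ) →
    ∫ x : ℝ, (p x : ℂ) * φ x = ((E / (4 * (1 - ν ^ 2)) : ℝ) : ℂ) * halfLaplacian u φ

end

/-! Put `c = E / (4 (1 - ν²))`, `h(t) = √(1 - t²) p(t)`, and let `S(w)` be the branch `tipRoot w` of
`√(w² - 1)`. Everything rests on one identity, `integral_pressure_div_sub`: for non-real `w`,
`∫_{-1}^1 h(t) / (t - w) dt = -c S(w) ∫ u(t) / (t - w)² dt`. It comes from pairing the pressure law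
with `√(1 - t²) / (t - w)`. The Stieltjes transform of the semicircle, `π (S(z) - z)`, gives the
half-Laplacian of this function in closed form. On `(-1, 1)` that is `-S(w) / (x - w)²`, because the
boundary values of `S` on the cut are imaginary and cancel. Its values elsewhere do not matter,
since `u` vanishes there.

The function is neither smooth nor supported away from the tips, so the pairing takes three limits.
The symbol `|k|` is damped by an exponential, which gives an explicit bounded kernel, and the
damping is removed. The test function is mollified, the mollifier being moved onto `u`. The support
is contracted to `[-a, a]` with `a < 1`, and then `a → 1` by dominated convergence, as `h` is
integrable.

Outside the fracture: for `x > 1` the law reads `p(x) = -(c / π) ∫ u(t) / (t - x)² dt`. Letting `w →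
x` in the identity gives `√(x² - 1) p(x) = (1 / π) ∫ h(t) / (t - x) dt`. As `x → 1⁺` the integrand
is dominated by `√(1 + t) / √(1 - t) |p(t)|`, and the first limit follows.

Inside: `∫ u(t) / (t - z)² dt` is the derivative of the Cauchy integral of `u`, whose imaginary part
tends to `π u` on the real line. The identity therefore yields `u'(x) = Re H(x + i0) / (c π √(1 -
x²))`, where `H` is the Cauchy integral of `h`. Under the Hölder hypothesis, integrability of `√(1 +
t) / √(1 - t) p` forces `h` to vanish at `1` at a Hölder rate, so `h` is Hölder up to and including
the tip. Then `|H'(x + iy)| ≤ B y^(s - 1)` uniformly near the tip, and `H` has boundary values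
continuous up to `x = 1`. There the value is `∫ h(t) / (t - 1) dt = -∫ √(1 + t) / √(1 - t) p(t) dt`,
which is the second limit. -/

/-! ### The Abel-regularised half-Laplacian -/

/-- The symbol `2π|ξ|` of `(-Δ)^{1/2}`, damped by `exp (-2πη|ξ|)`. -/
noncomputable def dampedSymbol (η ξ : ℝ) : ℂ :=
  ((2 * Real.pi * |ξ| * Real.exp (-(2 * Real.pi * η * |ξ|)) : ℝ) : ℂ)

/-- The convolution kernel with Fourier multiplier `dampedSymbol η`. -/
noncomputable def dampedKernel (η s : ℝ) : ℂ :=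
  -(1 / (2 * Real.pi)) * (1 / ((s : ℂ) - η * Complex.I) ^ 2 + 1 / ((s : ℂ) + η * Complex.I) ^ 2)

/-- The bilinear form of the multiplier `dampedSymbol η`. -/
noncomputable def dampedForm (η : ℝ) (f g : ℝ → ℂ) : ℂ :=
  ∫ ξ : ℝ, dampedSymbol η ξ * 𝓕 f ξ * 𝓕⁻ g ξ

lemma integrable_mul_exp_neg_mul_Ioi {b : ℝ} (hb : 0 < b) :
    IntegrableOn (fun t : ℝ => t * Real.exp (-(b * t))) (Ioi 0) := by
  have := integrableOn_rpow_mul_exp_neg_mul_rpow (s := 1) (p := 1) (b := b) (by norm_num)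
    (by norm_num) hb
  simpa using this

lemma integral_mul_cexp_neg_mul_Ioi {b : ℂ} (hb : 0 < b.re) :
    ∫ t : ℝ in Ioi 0, (t : ℂ) * Complex.exp (-(b * t)) = 1 / b ^ 2 := by
  have hb0 : b ≠ 0 := fun h => by simp [h] at hb
  have hd : ∀ t ∈ Ioi (0 : ℝ), HasDerivAt
      (fun t : ℝ => -((t : ℂ) / b + 1 / b ^ 2) * Complex.exp (-(b * t)))
      ((t : ℂ) * Complex.exp (-(b * t))) t := by
    intro t _
    have h1 : HasDerivAt (fun z : ℂ => -(z / b + 1 / b ^ 2) * Complex.exp (-(b * z)))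
        (-(1 / b) * Complex.exp (-(b * t)) +
          -((t : ℂ) / b + 1 / b ^ 2) * (Complex.exp (-(b * t)) * (-(b * 1)))) (t : ℂ) :=
      ((((hasDerivAt_id (t : ℂ)).div_const b).add_const _).neg).mul
        ((((hasDerivAt_id (t : ℂ)).const_mul b).neg).cexp)
    convert! h1.comp_ofReal using 1
    field_simp; ring
  have hnorm : ∀ t : ℝ, ‖Complex.exp (-(b * t))‖ = Real.exp (-(b.re * t)) := fun t => by
    rw [Complex.norm_exp]; simp
  have hint : IntegrableOn (fun t : ℝ => (t : ℂ) * Complex.exp (-(b * t))) (Ioi 0) := by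
    refine (integrable_mul_exp_neg_mul_Ioi hb).mono' (by fun_prop) ?_
    filter_upwards [ae_restrict_mem measurableSet_Ioi] with t ht
    rw [norm_mul, hnorm, Complex.norm_real, Real.norm_eq_abs, abs_of_pos (by exact ht)]
  have hlim : ∀ k : ℕ, Tendsto (fun t : ℝ => (t : ℂ) ^ k * Complex.exp (-(b * t))) atTop (𝓝 0) := by
    intro k
    rw [tendsto_zero_iff_norm_tendsto_zero]
    have h := (isLittleO_pow_exp_pos_mul_atTop k hb).tendsto_div_nhds_zero
    have h' := h.norm
    rw [norm_zero] at h'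
    refine h'.congr fun t => ?_
    rw [norm_mul, hnorm, norm_div, norm_pow, norm_pow, Complex.norm_real,
      Real.norm_of_nonneg (Real.exp_pos _).le, Real.exp_neg]
    rfl
  have h0 : Tendsto (fun t : ℝ => -((t : ℂ) / b + 1 / b ^ 2) * Complex.exp (-(b * t))) atTop
      (𝓝 0) := by
    have := ((hlim 1).const_mul (-(1 / b))).add ((hlim 0).const_mul (-(1 / b ^ 2)))
    simp only [mul_zero, add_zero] at this
    refine this.congr fun t => ?_
    ring
  rw [integral_Ioi_of_hasDerivAt_of_tendsto (Continuous.continuousWithinAt (by fun_prop)) hd hint h0]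
  simp

lemma continuous_dampedSymbol (η : ℝ) : Continuous (dampedSymbol η) := by
  unfold dampedSymbol; fun_prop

lemma integrable_dampedSymbol {η : ℝ} (hη : 0 < η) : Integrable (dampedSymbol η) := by
  have h2 : 0 < 2 * Real.pi * η := by positivity
  have h := (integrable_mul_exp_neg_mul_Ioi h2).const_mul (2 * Real.pi)
  refine Integrable.ofReal (f := fun ξ : ℝ =>
    2 * Real.pi * |ξ| * Real.exp (-(2 * Real.pi * η * |ξ|))) ?_
  have hIoi : IntegrableOn (fun ξ : ℝ => 2 * Real.pi * |ξ| * Real.exp (-(2 * Real.pi * η * |ξ|)))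
      (Ioi 0) := by
    refine Integrable.congr h ?_
    filter_upwards [ae_restrict_mem measurableSet_Ioi] with t ht
    rw [abs_of_pos (by exact ht), mul_assoc (2 * Real.pi) t]
  have hIic : IntegrableOn (fun ξ : ℝ => 2 * Real.pi * |ξ| * Real.exp (-(2 * Real.pi * η * |ξ|)))
      (Iic 0) := by
    rw [← Measure.map_neg_eq_self (volume : Measure ℝ)]
    let m : MeasurableEmbedding fun x : ℝ => -x := (Homeomorph.neg ℝ).measurableEmbedding
    rw [m.integrableOn_map_iff]
    simp_rw [Function.comp_def, abs_neg, neg_preimage, neg_Iic, neg_zero]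
    exact Iff.mpr integrableOn_Ici_iff_integrableOn_Ioi hIoi
  have := hIic.union hIoi
  rwa [Iic_union_Ioi, integrableOn_univ] at this

lemma norm_dampedSymbol_le {η : ℝ} (hη : 0 < η) (ξ : ℝ) :
    ‖dampedSymbol η ξ‖ ≤ 2 * Real.pi * |ξ| := by
  unfold dampedSymbol
  rw [Complex.norm_real, Real.norm_eq_abs, abs_of_nonneg (by positivity)]
  refine mul_le_of_le_one_right (by positivity) ?_
  rw [Real.exp_le_one_iff]
  have : 0 ≤ 2 * Real.pi * η * |ξ| := by positivity
  linarith

/-- Each half-line contributes a Laplace integral `1 / b²` with `b = 2π (η ± i s)`, and `(η ± i s)²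
= -(s ∓ i η)²`. -/
lemma integral_dampedSymbol_mul_cexp {η : ℝ} (hη : 0 < η) (s : ℝ) :
    ∫ ξ : ℝ, Complex.exp (-(2 * Real.pi * s * ξ * Complex.I)) * dampedSymbol η ξ
      = dampedKernel η s := by
  set F : ℝ → ℂ := fun ξ => Complex.exp (-(2 * Real.pi * s * ξ * Complex.I)) * dampedSymbol η ξ
    with hF
  have hint : Integrable F := by
    refine (integrable_dampedSymbol hη).norm.mono' ?_ (ae_of_all _ fun ξ => ?_)
    · exact (Continuous.mul (by fun_prop) (continuous_dampedSymbol η)).aestronglyMeasurable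
    · rw [hF, norm_mul, Complex.norm_exp]; simp
  have hpi : (2 * Real.pi : ℂ) ≠ 0 := by simp [Real.pi_ne_zero]
  have key : ∀ e : ℝ, e * e = 1 → ∫ t : ℝ in Ioi 0, F (e * t)
      = 2 * Real.pi * (1 / (2 * Real.pi * (η + e * s * Complex.I)) ^ 2) := by
    intro e he
    have habs : |e| = 1 := by
      rcases mul_self_eq_one_iff.1 he with h | h <;> simp [h]
    rw [← integral_mul_cexp_neg_mul_Ioi (b := 2 * Real.pi * (η + e * s * Complex.I)),
      ← integral_const_mul]
    · refine setIntegral_congr_fun measurableSet_Ioi fun t ht => ?_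
      have ht' : (0 : ℝ) < t := ht
      simp only [hF, dampedSymbol, abs_mul, habs, one_mul, abs_of_pos ht']
      push_cast
      rw [mul_left_comm, ← Complex.exp_add, mul_assoc]
      congr 3
      ring
    · simp; positivity
  have h1 := key 1 (by norm_num)
  have h2 := key (-1) (by norm_num)
  simp only [one_mul, neg_mul, Complex.ofReal_neg, Complex.ofReal_one] at h1 h2
  rw [← integral_add_compl measurableSet_Ioi (μ := volume) (f := F) (s := Ioi 0) hint, compl_Ioi,
    ← neg_zero, ← integral_comp_neg_Ioi, neg_zero, h1, h2, dampedKernel]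
  have e1 : (2 * Real.pi * (η + s * Complex.I) : ℂ) ^ 2
      = -((2 * Real.pi) ^ 2 * ((s : ℂ) - η * Complex.I) ^ 2) := by
    ring_nf; simp; ring
  have e2 : (2 * Real.pi * (η + -(s * Complex.I)) : ℂ) ^ 2
      = -((2 * Real.pi) ^ 2 * ((s : ℂ) + η * Complex.I) ^ 2) := by
    ring_nf; simp; ring
  have n1 : (s : ℂ) - η * Complex.I ≠ 0 := fun h => by
    have := congrArg Complex.im h; simp at this; exact hη.ne' this
  have n2 : (s : ℂ) + η * Complex.I ≠ 0 := fun h => by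
    have := congrArg Complex.im h; simp at this; exact hη.ne' this
  rw [e1, e2]
  field_simp
  ring

/-- The duality `∫ 𝓕 f · h = ∫ f · 𝓕 h` is used twice, for `f` and for the reflection of `g`. The
damping makes the symbol integrable, so both uses are legitimate for merely integrable `f` and `g`.
-/
lemma dampedForm_eq_integral {η : ℝ} (hη : 0 < η) {f g : ℝ → ℂ} (hf : Integrable f)
    (hg : Integrable g) :
    dampedForm η f g = ∫ x, f x * ∫ y, g y * dampedKernel η (x - y) := by
  have hm := integrable_dampedSymbol hη
  have hL : Continuous fun q : ℝ × ℝ => (innerₗ ℝ) q.1 q.2 := continuous_inner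
  have dual : ∀ f h : ℝ → ℂ, Integrable f → Integrable h →
      ∫ ξ, 𝓕 f ξ * h ξ = ∫ x, f x * 𝓕 h x := by
    intro f h hf hh
    have := VectorFourier.integral_fourierIntegral_smul_eq_flip (L := innerₗ ℝ)
      Real.continuous_fourierChar hL hf hh
    simpa [Real.fourier_eq, VectorFourier.fourierIntegral, mul_comm] using this
  have hgc : Continuous (𝓕⁻ g) := by
    have : 𝓕⁻ g = fun ξ => 𝓕 g (-ξ) := by
      ext ξ; exact Real.fourierInv_eq_fourier_neg g ξ
    rw [this]
    have h0 : Continuous (𝓕 g) :=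
      VectorFourier.fourierIntegral_continuous Real.continuous_fourierChar hL hg
    exact h0.comp continuous_neg
  have hgb : ∀ ξ, ‖𝓕⁻ g ξ‖ ≤ ∫ y, ‖g y‖ := fun ξ => by
    rw [Real.fourierInv_eq_fourier_neg]
    exact VectorFourier.norm_fourierIntegral_le_integral_norm _ _ _ _ _
  have hh : Integrable fun ξ => dampedSymbol η ξ * 𝓕⁻ g ξ :=
    hm.mul_bdd hgc.aestronglyMeasurable (ae_of_all _ hgb)
  have h1 : dampedForm η f g = ∫ ξ, 𝓕 f ξ * (dampedSymbol η ξ * 𝓕⁻ g ξ) := by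
    unfold dampedForm; congr 1; ext ξ; ring
  rw [h1, dual f _ hf hh]
  congr 1; ext x; congr 1
  set k : ℝ → ℂ := fun ξ => Complex.exp (-(2 * Real.pi * x * ξ * Complex.I)) * dampedSymbol η ξ
    with hk
  have hkint : Integrable k := by
    refine hm.norm.mono' ?_ (ae_of_all _ fun ξ => ?_)
    · exact (Continuous.mul (by fun_prop) (continuous_dampedSymbol η)).aestronglyMeasurable
    · rw [hk, norm_mul, Complex.norm_exp]; simp
  have h2 : 𝓕 (fun ξ => dampedSymbol η ξ * 𝓕⁻ g ξ) x
      = ∫ ξ, 𝓕 (fun y => g (-y)) ξ * k ξ := by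
    rw [Real.fourier_eq']
    congr 1; ext ξ
    rw [Real.fourierInv_eq_fourier_comp_neg]
    simp only [smul_eq_mul, hk]
    rw [show Complex.exp (((-2 * Real.pi * inner ℝ ξ x : ℝ) : ℂ) * Complex.I)
      = Complex.exp (-(2 * Real.pi * x * ξ * Complex.I)) by
        congr 1; simp; ring]
    ring
  rw [h2, dual _ _ hg.comp_neg hkint, ← integral_neg_eq_self]
  congr 1; ext y
  rw [neg_neg, ← integral_dampedSymbol_mul_cexp hη, Real.fourier_eq']
  congr 1
  congr 1; ext ξ
  simp only [smul_eq_mul, hk]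
  rw [← mul_assoc, ← Complex.exp_add]
  congr 2
  simp; ring

lemma tendsto_dampedForm_halfLaplacian {u : ℝ → ℝ} (hu : Integrable u) (φ : 𝓢(ℝ, ℂ)) :
    Tendsto (fun η => dampedForm η (fun x => (u x : ℂ)) φ) (𝓝[>] 0) (𝓝 (halfLaplacian u φ)) := by
  have hL : Continuous fun q : ℝ × ℝ => (innerₗ ℝ) q.1 q.2 := continuous_inner
  have hu' : Integrable fun x => (u x : ℂ) := hu.ofReal
  have hφ : (𝓕⁻ (φ : ℝ → ℂ)) = ((𝓕⁻ φ : 𝓢(ℝ, ℂ)) : ℝ → ℂ) := (SchwartzMap.fourierInv_coe φ).symm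
  have hc : Continuous (𝓕 fun x => (u x : ℂ)) :=
    VectorFourier.fourierIntegral_continuous Real.continuous_fourierChar hL hu'
  unfold dampedForm halfLaplacian
  rw [hφ]
  refine tendsto_integral_filter_of_dominated_convergence
    (fun ξ => (2 * Real.pi * ∫ x, ‖(u x : ℂ)‖) * (‖ξ‖ ^ 1 * ‖(𝓕⁻ φ : 𝓢(ℝ, ℂ)) ξ‖)) ?_ ?_ ?_ ?_
  · exact Eventually.of_forall fun η => (((continuous_dampedSymbol η).mul hc).mul
      (SchwartzMap.continuous _)).aestronglyMeasurable
  · filter_upwards [self_mem_nhdsWithin] with η hη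
    refine ae_of_all _ fun ξ => ?_
    rw [norm_mul, norm_mul]
    have h1 := norm_dampedSymbol_le hη ξ
    have h2 : ‖𝓕 (fun x => (u x : ℂ)) ξ‖ ≤ ∫ x, ‖(u x : ℂ)‖ :=
      VectorFourier.norm_fourierIntegral_le_integral_norm _ _ _ _ _
    calc _ ≤ (2 * Real.pi * |ξ|) * (∫ x, ‖(u x : ℂ)‖) * ‖(𝓕⁻ φ : 𝓢(ℝ, ℂ)) ξ‖ := by gcongr
      _ = _ := by rw [pow_one, Real.norm_eq_abs]; ring
  · exact (SchwartzMap.integrable_pow_mul volume _ 1).const_mul _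
  · refine ae_of_all _ fun ξ => ?_
    refine Tendsto.mul_const _ (Tendsto.mul_const _ ?_)
    have : Continuous fun η => dampedSymbol η ξ := by unfold dampedSymbol; fun_prop
    have h := this.tendsto 0
    simp only [dampedSymbol, mul_zero, zero_mul, neg_zero, Real.exp_zero, mul_one] at h
    exact h.mono_left nhdsWithin_le_nhds

/-- An even `ρ` has an even Fourier transform, so this factor can be attached to either argument
although one of them is transformed inversely. -/
lemma dampedForm_convolution {ρ : ℝ → ℝ} (hρ : Integrable ρ) (hev : ∀ x, ρ (-x) = ρ x)
    {f g : ℝ → ℂ} (hf : Integrable f) (hg : Integrable g) (η : ℝ) :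
    dampedForm η f (convolution ρ g (ContinuousLinearMap.lsmul ℝ ℝ) volume)
      = dampedForm η (convolution ρ f (ContinuousLinearMap.lsmul ℝ ℝ) volume) g := by
  have hc : ∀ h : ℝ → ℂ, Integrable h → ∀ ξ,
      𝓕 (convolution ρ h (ContinuousLinearMap.lsmul ℝ ℝ) volume) ξ
        = 𝓕 (fun x => (ρ x : ℂ)) ξ * 𝓕 h ξ := by
    intro h hh ξ
    have := Real.fourier_smul_convolution_eq (f₁ := fun x => (ρ x : ℂ)) hρ.ofReal hh ξ
    rw [smul_eq_mul] at this
    rw [← this]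
    congr 1
  have hρev : ∀ ξ, 𝓕 (fun x => (ρ x : ℂ)) (-ξ) = 𝓕 (fun x => (ρ x : ℂ)) ξ := by
    intro ξ
    rw [← Real.fourierInv_eq_fourier_neg, Real.fourierInv_eq_fourier_comp_neg]
    simp [hev]
  unfold dampedForm
  congr 1; ext ξ
  rw [Real.fourierInv_eq_fourier_neg, Real.fourierInv_eq_fourier_neg, hc g hg, hc f hf, hρev]
  ring

/-! ### Testing the pressure law with continuous functions -/

lemma tendsto_integral_mul_of_bounded {h : ℝ → ℂ} {R B : ℝ} (hh : IntegrableOn h (Icc (-R) R))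
    {f : ℕ → ℝ → ℂ} {g : ℝ → ℂ} (hf : ∀ n, Continuous (f n)) (hfB : ∀ n x, ‖f n x‖ ≤ B)
    (hf0 : ∀ n x, R < |x| → f n x = 0) (hlim : ∀ x, Tendsto (fun n => f n x) atTop (𝓝 (g x))) :
    Tendsto (fun n => ∫ x, h x * f n x) atTop (𝓝 (∫ x, h x * g x)) := by
  have hind : ∀ n, ∫ x, h x * f n x = ∫ x, (Icc (-R) R).indicator h x * f n x := by
    intro n; congr 1; ext x
    by_cases hx : x ∈ Icc (-R) R
    · rw [indicator_of_mem hx]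
    · rw [hf0 n x (by rw [← not_le, abs_le]; exact hx)]; simp
  have hind' : ∫ x, h x * g x = ∫ x, (Icc (-R) R).indicator h x * g x := by
    congr 1; ext x
    by_cases hx : x ∈ Icc (-R) R
    · rw [indicator_of_mem hx]
    · have : g x = 0 := by
        refine tendsto_nhds_unique (hlim x) ?_
        simp_rw [hf0 _ x (by rw [← not_le, abs_le]; exact hx)]
        exact tendsto_const_nhds
      rw [this]; simp
  simp_rw [hind, hind']
  have hI : Integrable ((Icc (-R) R).indicator h) := hh.integrable_indicator measurableSet_Icc
  refine tendsto_integral_of_dominated_convergence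
    (fun x => ‖(Icc (-R) R).indicator h x‖ * B) ?_ (hI.norm.mul_const B) ?_ ?_
  · exact fun n => hI.aestronglyMeasurable.mul (hf n).aestronglyMeasurable
  · intro n
    refine ae_of_all _ fun x => ?_
    rw [norm_mul]
    exact mul_le_mul_of_nonneg_left (hfB n x) (norm_nonneg _)
  · exact ae_of_all _ fun x => (hlim x).const_mul _

/-- A sequence of bump functions of radius at most `δ` that shrinks to the origin. -/
noncomputable def shrinkingBump {δ : ℝ} (hδ : 0 < δ) (n : ℕ) : ContDiffBump (0 : ℝ) where
  rIn := δ / (2 * (n + 1))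
  rOut := δ / (n + 1)
  rIn_pos := by positivity
  rIn_lt_rOut := by
    apply div_lt_div_of_pos_left hδ (by positivity)
    have : (0 : ℝ) < n + 1 := by positivity
    linarith

/-- Convolution with the bump functions `shrinkingBump`. -/
noncomputable def mollify {δ : ℝ} (hδ : 0 < δ) (n : ℕ) (f : ℝ → ℂ) : ℝ → ℂ :=
  convolution ((shrinkingBump hδ n).normed volume) f (ContinuousLinearMap.lsmul ℝ ℝ) volume

section Mollify

variable {δ : ℝ} (hδ : 0 < δ) {f : ℝ → ℂ}

lemma contDiff_mollify (hf : Continuous f) (n : ℕ) : ContDiff ℝ ((⊤ : ℕ∞) : WithTop ℕ∞) (mollify hδ n f) :=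
  HasCompactSupport.contDiff_convolution_left _ (ContDiffBump.hasCompactSupport_normed _)
    (ContDiffBump.contDiff_normed _) hf.locallyIntegrable

lemma mollify_eq_zero {R : ℝ} (hR : ∀ x, R < |x| → f x = 0) (n : ℕ) {x : ℝ} (hx : R + δ < |x|) :
    mollify hδ n f x = 0 := by
  have hsub : ∀ t, (shrinkingBump hδ n).normed volume t • f (x - t) = 0 := by
    intro t
    by_cases ht : |t| < δ
    · rw [hR (x - t), smul_zero]
      have := abs_sub_abs_le_abs_sub x t
      linarith
    · have : (shrinkingBump hδ n).normed volume t = 0 := by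
        rw [← Function.notMem_support, ContDiffBump.support_normed_eq, Metric.mem_ball,
          dist_zero_right, Real.norm_eq_abs]
        intro h
        refine ht (h.trans_le ?_)
        exact div_le_self hδ.le (by norm_cast; omega)
      rw [this, zero_smul]
  simp only [mollify, convolution, ContinuousLinearMap.lsmul_apply, hsub, integral_zero]

lemma norm_mollify_le {B : ℝ} (hf : Continuous f) (hB : ∀ x, ‖f x‖ ≤ B) (n : ℕ) (x : ℝ) :
    ‖mollify hδ n f x‖ ≤ 3 * B := by
  have h1 : dist (mollify hδ n f x) (f x) ≤ 2 * B :=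
    ContDiffBump.dist_normed_convolution_le hf.aestronglyMeasurable fun y _ => by
      rw [dist_eq_norm]
      exact (norm_sub_le _ _).trans (by linarith [hB x, hB y])
  have h2 : ‖mollify hδ n f x‖ ≤ ‖mollify hδ n f x - f x‖ + ‖f x‖ := by
    simpa using norm_add_le (mollify hδ n f x - f x) (f x)
  rw [dist_eq_norm] at h1
  linarith [hB x]

lemma tendsto_mollify (hf : Continuous f) (x : ℝ) :
    Tendsto (fun n => mollify hδ n f x) atTop (𝓝 (f x)) := by
  refine ContDiffBump.convolution_tendsto_right_of_continuous ?_ hf x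
  have := tendsto_one_div_add_atTop_nhds_zero_nat (𝕜 := ℝ) |>.const_mul δ
  simpa [shrinkingBump, div_eq_mul_inv] using this

lemma hasCompactSupport_of_eq_zero {R : ℝ} (hR : ∀ x, R < |x| → f x = 0) : HasCompactSupport f :=
  HasCompactSupport.intro (isCompact_Icc (a := -R) (b := R)) fun x hx =>
    hR x (by rw [← not_le, abs_le]; exact hx)

lemma dampedForm_mollify {R R' : ℝ} {g : ℝ → ℂ} (hf : Continuous f) (hg : Continuous g)
    (hfR : ∀ x, R < |x| → f x = 0) (hgR : ∀ x, R' < |x| → g x = 0) (n : ℕ) (η : ℝ) :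
    dampedForm η f (mollify hδ n g) = dampedForm η (mollify hδ n f) g :=
  dampedForm_convolution (ContDiffBump.integrable_normed _)
    (fun x => ContDiffBump.normed_neg _ x)
    (hf.integrable_of_hasCompactSupport (hasCompactSupport_of_eq_zero hfR))
    (hg.integrable_of_hasCompactSupport (hasCompactSupport_of_eq_zero hgR)) η

end Mollify

/-- Extends the law from smooth to continuous test functions supported strictly inside the fracture.
The mollified `φ` is admissible; moving the mollifier onto `u` puts the rough `φ` back into the
damped form, where `hlim` identifies the limit. The dilation `a` in `hlim` accommodates the
contracted test functions used later. -/
lemma PressureLaw.integral_mul_eq {E ν : ℝ} {u p : ℝ → ℝ} (hp : PressureLaw E ν u p)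
    (hu : Continuous u) (hu0 : ∀ x, 1 < |x| → u x = 0) {φ : ℝ → ℂ} (hφ : Continuous φ)
    {b : ℝ} (hb : b < 1) (hφb : ∀ x, b < |x| → φ x = 0) {K : ℝ → ℂ} (hK : LocallyIntegrable K)
    {a : ℝ} (ha : 0 < a)
    (hlim : ∀ v : ℝ → ℂ, Continuous v → HasCompactSupport v →
      Tendsto (fun η => dampedForm η v φ) (𝓝[>] 0) (𝓝 (∫ x, K x * v (a * x)))) :
    ∫ x, (p x : ℂ) * φ x
      = ((E / (4 * (1 - ν ^ 2)) : ℝ) : ℂ) * ∫ x, K x * (u (a * x) : ℂ) := by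
  -- Half the gap to the tips: mollification at scale at most `δ` keeps the support in `[-(b + δ), b
  -- + δ]`, which misses `±1`.
  set δ := (1 - b) / 2 with hδd
  have hδ : 0 < δ := by simp only [hδd]; linarith
  set U : ℝ → ℂ := fun x => (u x : ℂ) with hU
  have hUc : Continuous U := Complex.continuous_ofReal.comp hu
  have hU0 : ∀ x, 1 < |x| → U x = 0 := fun x hx => by simp [hU, hu0 x hx]
  have hUs := hasCompactSupport_of_eq_zero hU0
  have hφs := hasCompactSupport_of_eq_zero hφb
  obtain ⟨BU, hBU⟩ := hUc.bounded_above_of_compact_support hUs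
  obtain ⟨Bφ, hBφ⟩ := hφ.bounded_above_of_compact_support hφs
  have huint : Integrable u := hu.integrable_of_hasCompactSupport
    (HasCompactSupport.intro (isCompact_Icc (a := -1) (b := 1)) fun x hx =>
      hu0 x (by rw [← not_le, abs_le]; exact hx))
  have hsub : Icc (-(b + δ)) (b + δ) ⊆ ({-1, 1}ᶜ : Set ℝ) := by
    intro x hx h
    simp only [hδd, mem_Icc] at hx
    rcases h with rfl | h
    · linarith
    · rw [mem_singleton_iff] at h; linarith
  have hpI : IntegrableOn (fun x => (p x : ℂ)) (Icc (-(b + δ)) (b + δ)) :=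
    (hp.1.integrableOn_compact_subset hsub isCompact_Icc).ofReal
  have hn : ∀ n, ∫ x, (p x : ℂ) * mollify hδ n φ x
      = ((E / (4 * (1 - ν ^ 2)) : ℝ) : ℂ) * ∫ x, K x * mollify hδ n U (a * x) := by
    intro n
    have h0 : ∀ x, b + δ < |x| → mollify hδ n φ x = 0 := fun x hx => mollify_eq_zero hδ hφb n hx
    have hcs := hasCompactSupport_of_eq_zero h0
    set Φ : 𝓢(ℝ, ℂ) := hcs.toSchwartzMap (contDiff_mollify hδ hφ n) with hΦ
    have hΦc : (Φ : ℝ → ℂ) = mollify hδ n φ := rfl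
    have h1 := hp.2 Φ hcs (by
      refine (closure_minimal ?_ isClosed_Icc).trans hsub
      intro x hx
      by_contra hx'
      exact hx (h0 x (by rw [← not_le, abs_le]; exact hx')))
    rw [hΦc] at h1
    rw [h1]
    congr 1
    -- The damping is removed while `n` is still fixed: with the mollifier on either argument this
    -- is the same family in `η`, so its two limits agree.
    refine tendsto_nhds_unique (tendsto_dampedForm_halfLaplacian huint Φ) ?_
    have h2 : ∀ η, dampedForm η (fun x => (u x : ℂ)) Φ = dampedForm η (mollify hδ n U) φ :=
      fun η => dampedForm_mollify hδ hUc hφ hU0 hφb n η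
    simp_rw [h2]
    refine hlim _ (contDiff_mollify hδ hUc n).continuous ?_
    exact hasCompactSupport_of_eq_zero (R := 1 + δ) fun x hx => mollify_eq_zero hδ hU0 n hx
  have hL := tendsto_integral_mul_of_bounded hpI
    (fun n => (contDiff_mollify hδ hφ n).continuous) (norm_mollify_le hδ hφ hBφ)
    (fun n x hx => mollify_eq_zero hδ hφb n hx) (tendsto_mollify hδ hφ)
  have hR := tendsto_integral_mul_of_bounded (R := (1 + δ) / a)
    (hK.integrableOn_isCompact isCompact_Icc)
    (fun n => (contDiff_mollify hδ hUc n).continuous.comp (continuous_const_mul a))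
    (fun n x => norm_mollify_le hδ hUc hBU n (a * x))
    (fun n x hx => mollify_eq_zero hδ hU0 n (x := a * x) (by
      rw [abs_mul, abs_of_pos ha]; rwa [div_lt_iff₀' ha] at hx))
    (fun x => tendsto_mollify hδ hUc (a * x))
  simp_rw [hn] at hL
  exact tendsto_nhds_unique hL (hR.const_mul _)

/-! ### The square root `√(z² - 1)` and the Stieltjes transform of the semicircle -/

namespace Complex

lemma sqrt_sq_self (z : ℂ) : z.sqrt ^ 2 = z := by
  simp [Complex.sqrt]

lemma abs_re_lt_norm_of_im_ne_zero {z : ℂ} (hz : z.im ≠ 0) : |z.re| < ‖z‖ :=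
  Complex.abs_re_lt_norm.2 hz

lemma re_sqrt_pos {z : ℂ} (hz : z.im ≠ 0) : 0 < z.sqrt.re := by
  rw [Complex.sqrt, Complex.cpow_inv_two_re]
  have := (abs_lt.1 (abs_re_lt_norm_of_im_ne_zero hz)).1
  exact Real.sqrt_pos.2 (by linarith)

lemma im_sqrt_mul_im_pos {z : ℂ} (hz : z.im ≠ 0) : 0 < z.sqrt.im * z.im := by
  have h := congrArg Complex.im (sqrt_sq_self z)
  rw [sq, Complex.mul_im] at h
  have hr := re_sqrt_pos hz
  have : z.sqrt.im ≠ 0 := fun h0 => hz (by rw [← h, h0]; ring)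
  have h2 : 0 < z.sqrt.im ^ 2 := by positivity
  rw [← h]
  nlinarith [mul_pos hr h2]

lemma norm_sqrt (z : ℂ) : ‖z.sqrt‖ = √‖z‖ := by
  conv_rhs => rw [← sqrt_sq_self z, norm_pow, Real.sqrt_sq (norm_nonneg _)]

lemma sqrt_conj {z : ℂ} (hz : z.im ≠ 0) :
    ((starRingEnd ℂ) z).sqrt = (starRingEnd ℂ) z.sqrt := by
  have harg : z.arg ≠ Real.pi := fun h => hz (Complex.arg_eq_pi_iff.1 h).2
  have := Complex.conj_cpow z (2⁻¹ : ℂ) harg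
  rw [map_inv₀, Complex.conj_ofNat] at this
  exact this

lemma hasDerivAt_sqrt_of_im_ne_zero {z : ℂ} (hz : z.im ≠ 0) :
    HasDerivAt Complex.sqrt (1 / (2 * z.sqrt)) z := by
  have hz0 : z ≠ 0 := fun h => hz (by simp [h])
  have hs : z.sqrt ≠ 0 := fun h => hz0 (by rw [← sqrt_sq_self z, h]; simp)
  have h := (hasDerivAt_id z).cpow_const (c := (2⁻¹ : ℂ)) (Or.inr hz)
  convert! h using 1
  simp only [id]
  rw [Complex.cpow_sub _ _ hz0, Complex.cpow_one]
  change _ = _ * (z.sqrt / z) * 1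
  nth_rw 3 [← sqrt_sq_self z]
  field_simp

lemma continuousOn_sqrt_upper : ContinuousOn Complex.sqrt {z | 0 ≤ z.im} := by
  have : Continuous fun a : ℂ =>
      ((√((‖a‖ + a.re) / 2) : ℝ) : ℂ) + 1 * ((√((‖a‖ - a.re) / 2) : ℝ) : ℂ) * Complex.I := by
    fun_prop
  refine this.continuousOn.congr fun z hz => ?_
  rw [Complex.sqrt_eq_real_add_ite, if_pos (by exact hz)]

end Complex

/-- The branch of `√(z² - 1)` that is holomorphic off the half-line `(-∞, 1]` and continuous up to
the real line from above. -/
noncomputable def tipRoot (z : ℂ) : ℂ := (z - 1).sqrt * (z + 1).sqrt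

lemma tipRoot_sq (z : ℂ) : tipRoot z ^ 2 = z ^ 2 - 1 := by
  rw [tipRoot, mul_pow, Complex.sqrt_sq_self, Complex.sqrt_sq_self]; ring

lemma norm_tipRoot (z : ℂ) : ‖tipRoot z‖ = √‖z - 1‖ * √‖z + 1‖ := by
  rw [tipRoot, norm_mul, Complex.norm_sqrt, Complex.norm_sqrt]

lemma norm_tipRoot_le (z : ℂ) : ‖tipRoot z‖ ≤ ‖z‖ + 1 := by
  have h : ‖tipRoot z‖ ^ 2 ≤ (‖z‖ + 1) ^ 2 := by
    rw [← norm_pow, tipRoot_sq]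
    refine (norm_sub_le _ _).trans ?_
    rw [norm_pow, norm_one]
    nlinarith [norm_nonneg z]
  exact (abs_le.1 (abs_le_of_sq_le_sq h (by positivity))).2

lemma tipRoot_ne_zero {z : ℂ} (hz : z.im ≠ 0) : tipRoot z ≠ 0 := by
  intro h
  have h2 := tipRoot_sq z
  rw [h] at h2
  have h3 : (z - 1) * (z + 1) = 0 := by linear_combination -h2
  rcases mul_eq_zero.1 h3 with h4 | h4
  · exact hz (by rw [sub_eq_zero.1 h4]; simp)
  · exact hz (by rw [eq_neg_of_add_eq_zero_left h4]; simp)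

lemma tipRoot_conj {z : ℂ} (hz : z.im ≠ 0) :
    tipRoot ((starRingEnd ℂ) z) = (starRingEnd ℂ) (tipRoot z) := by
  rw [tipRoot, tipRoot, map_mul, ← Complex.sqrt_conj (by simpa), ← Complex.sqrt_conj (by simpa)]
  simp

lemma hasDerivAt_tipRoot {z : ℂ} (hz : z.im ≠ 0) : HasDerivAt tipRoot (z / tipRoot z) z := by
  have h1 : (z - 1).im ≠ 0 := by simpa
  have h2 : (z + 1).im ≠ 0 := by simpa
  have h := ((Complex.hasDerivAt_sqrt_of_im_ne_zero h1).comp_sub_const z 1).mul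
    ((Complex.hasDerivAt_sqrt_of_im_ne_zero h2).comp_add_const z 1)
  have n1 : (z - 1).sqrt ≠ 0 := fun h => tipRoot_ne_zero hz (by rw [tipRoot, h, zero_mul])
  have n2 : (z + 1).sqrt ≠ 0 := fun h => tipRoot_ne_zero hz (by rw [tipRoot, h, mul_zero])
  convert! h using 1
  rw [tipRoot]
  field_simp
  rw [Complex.sqrt_sq_self, Complex.sqrt_sq_self]; ring

lemma continuousOn_tipRoot : ContinuousOn tipRoot {z | 0 ≤ z.im} := by
  refine ContinuousOn.mul ?_ ?_
  · exact Complex.continuousOn_sqrt_upper.comp (by fun_prop) fun z hz => by simpa using hz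
  · exact Complex.continuousOn_sqrt_upper.comp (by fun_prop) fun z hz => by simpa using hz

lemma tipRoot_ofReal_of_mem_Ioo {t : ℝ} (ht : t ∈ Ioo (-1 : ℝ) 1) :
    tipRoot t = √(1 - t ^ 2) * Complex.I := by
  have h1 : ((t : ℂ) - 1).sqrt = Complex.I * √(1 - t) := by
    have := Complex.sqrt_neg_of_nonneg (a := ((1 - t : ℝ) : ℂ)) (by
      rw [Complex.zero_le_real]; linarith [ht.2])
    rw [Complex.sqrt_of_nonneg (a := ((1 - t : ℝ) : ℂ)) (by
      rw [Complex.zero_le_real]; linarith [ht.2]), Complex.ofReal_re] at this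
    rw [← this]; congr 1; push_cast; ring
  have h2 : ((t : ℂ) + 1).sqrt = √(1 + t) := by
    have := Complex.sqrt_of_nonneg (a := ((1 + t : ℝ) : ℂ)) (by
      rw [Complex.zero_le_real]; linarith [ht.1])
    rw [Complex.ofReal_re] at this
    rw [← this]; congr 1; push_cast; ring
  rw [tipRoot, h1, h2, show 1 - t ^ 2 = (1 - t) * (1 + t) by ring,
    Real.sqrt_mul (by linarith [ht.2])]
  push_cast; ring

lemma tipRoot_ofReal_of_one_lt {x : ℝ} (hx : 1 < x) :
    tipRoot x = ((√(x - 1) * √(x + 1) : ℝ) : ℂ) := by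
  have h : ∀ y : ℝ, 0 < y → ((y : ℝ) : ℂ).sqrt = √y := fun y hy => by
    rw [Complex.sqrt_of_nonneg (by rw [Complex.zero_le_real]; exact hy.le), Complex.ofReal_re]
  rw [tipRoot, show (x : ℂ) - 1 = ((x - 1 : ℝ) : ℂ) by simp,
    show (x : ℂ) + 1 = ((x + 1 : ℝ) : ℂ) by simp, h _ (by linarith), h _ (by linarith)]
  push_cast; ring

/-- With `α = √(z - 1)` and `β = √(z + 1)` one has `z - αβ = (α - β)² / 2` and `(α - β)(α + β) =
-2`, so the claim amounts to `|α - β| < |α + β|`. This holds because `α` and `β` lie in the same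
open quadrant. It makes `z - tipRoot z` the root of `J + 1 / J = 2 z` inside the unit disc. -/
lemma norm_sub_tipRoot_lt_one {z : ℂ} (hz : z.im ≠ 0) : ‖z - tipRoot z‖ < 1 := by
  set α := (z - 1).sqrt with hα
  set β := (z + 1).sqrt with hβ
  have hα2 : α ^ 2 = z - 1 := Complex.sqrt_sq_self _
  have hβ2 : β ^ 2 = z + 1 := Complex.sqrt_sq_self _
  have e1 : z - tipRoot z = (α - β) ^ 2 / 2 := by
    rw [tipRoot, ← hα, ← hβ]; linear_combination (-1 / 2) * hα2 - (1 / 2) * hβ2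
  have e2 : (α - β) * (α + β) = -2 := by linear_combination hα2 - hβ2
  have i1 : (z - 1).im = z.im := by simp
  have i2 : (z + 1).im = z.im := by simp
  have rα := Complex.re_sqrt_pos (z := z - 1) (by rwa [i1])
  have rβ := Complex.re_sqrt_pos (z := z + 1) (by rwa [i2])
  have iα := Complex.im_sqrt_mul_im_pos (z := z - 1) (by rwa [i1])
  have iβ := Complex.im_sqrt_mul_im_pos (z := z + 1) (by rwa [i2])
  rw [← hα] at rα iα
  rw [← hβ] at rβ iβ
  rw [i1] at iα
  rw [i2] at iβ
  have him : 0 < α.im * β.im := by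
    by_contra h
    nlinarith [mul_pos iα iβ, mul_self_pos.2 hz]
  have hlt : Complex.normSq (α - β) < Complex.normSq (α + β) := by
    rw [Complex.normSq_apply, Complex.normSq_apply]
    simp only [Complex.sub_re, Complex.sub_im, Complex.add_re, Complex.add_im]
    nlinarith [mul_pos rα rβ]
  rw [Complex.normSq_eq_norm_sq, Complex.normSq_eq_norm_sq] at hlt
  have hprod : ‖α - β‖ * ‖α + β‖ = 2 := by rw [← norm_mul, e2]; simp
  rw [e1, norm_div, norm_pow]
  have : ‖α - β‖ < ‖α + β‖ := lt_of_pow_lt_pow_left₀ 2 (norm_nonneg _) hlt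
  simp only [Complex.norm_ofNat]
  nlinarith [norm_nonneg (α - β), norm_nonneg (α + β)]

/-- The difference of two geometric series with ratios `J e^{iθ}` and `J e^{-iθ}`. -/
lemma hasSum_pow_mul_sin {J : ℂ} (hJ : ‖J‖ < 1) (θ : ℝ) :
    HasSum (fun n : ℕ => J ^ n * (Real.sin ((n + 1) * θ) : ℂ))
      (Real.sin θ / (1 - 2 * J * Real.cos θ + J ^ 2)) := by
  have hgeom : ∀ e : ℂ, ‖e‖ = 1 → HasSum (fun n : ℕ => (J * e) ^ n * e) (e / (1 - J * e)) := by
    intro e he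
    have h := (hasSum_geometric_of_norm_lt_one (ξ := J * e) (by rw [norm_mul, he, mul_one]; exact hJ))
    rw [div_eq_inv_mul]
    exact h.mul_right e
  have hne : ∀ e : ℂ, ‖e‖ = 1 → 1 - J * e ≠ 0 := by
    intro e he h
    have : ‖J * e‖ = 1 := by rw [← sub_eq_zero.1 h]; simp
    rw [norm_mul, he, mul_one] at this
    linarith
  set e := Complex.exp (θ * Complex.I) with he
  set e' := Complex.exp (-(θ * Complex.I)) with he'
  have n1 : ‖e‖ = 1 := Complex.norm_exp_ofReal_mul_I θ
  have n2 : ‖e'‖ = 1 := by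
    rw [he', ← neg_mul, ← Complex.ofReal_neg]; exact Complex.norm_exp_ofReal_mul_I _
  have hee : e * e' = 1 := by rw [he, he', ← Complex.exp_add]; simp
  have hsin : (Real.sin θ : ℂ) = (e' - e) * Complex.I / 2 := by
    rw [Complex.ofReal_sin, Complex.sin, he, he', neg_mul]
  have hcos : (Real.cos θ : ℂ) = (e + e') / 2 := by
    rw [Complex.ofReal_cos, Complex.cos, he, he', neg_mul]
  have h := ((hgeom e' n2).sub (hgeom e n1)).mul_right (Complex.I / 2)
  have hden : (1 - 2 * J * Real.cos θ + J ^ 2 : ℂ) = (1 - J * e) * (1 - J * e') := by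
    rw [hcos]; linear_combination (-J ^ 2) * hee
  convert! h using 1
  · ext n
    have hp : ∀ x : ℂ, Complex.exp x ^ n * Complex.exp x = Complex.exp ((n + 1) * x) := by
      intro x; rw [← pow_succ, ← Complex.exp_nat_mul]; push_cast; rfl
    rw [Complex.ofReal_sin, Complex.sin, mul_pow, mul_pow, mul_assoc, mul_assoc, he, he', hp, hp]
    push_cast
    ring_nf
  · rw [hden, hsin]
    have m1 := hne e n1
    have m2 := hne e' n2
    rw [div_sub_div _ _ m2 m1, div_mul_eq_mul_div, mul_comm (1 - J * e') (1 - J * e)]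
    congr 1
    ring

lemma integral_sin_mul_sin_succ (n : ℕ) :
    ∫ θ in (0 : ℝ)..Real.pi, Real.sin θ * Real.sin ((n + 1) * θ)
      = if n = 0 then Real.pi / 2 else 0 := by
  split_ifs with hn
  · subst hn
    have := integral_sin_sq (a := 0) (b := Real.pi)
    simp only [CharP.cast_eq_zero, zero_add, one_mul, ← sq]
    rw [this]; simp
  · have hc : ∀ m : ℕ, m ≠ 0 → ∫ θ in (0 : ℝ)..Real.pi, Real.cos (m * θ) = 0 := by
      intro m hm
      rw [intervalIntegral.integral_comp_mul_left (fun x => Real.cos x) (by exact_mod_cast hm)]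
      simp
    have h1 : ∀ θ : ℝ, Real.sin θ * Real.sin ((n + 1) * θ)
        = (Real.cos ((n : ℕ) * θ) - Real.cos (((n + 2 : ℕ) : ℝ) * θ)) / 2 := by
      intro θ
      rw [show ((n : ℕ) : ℝ) * θ = (n + 1) * θ - θ by ring,
        show ((n + 2 : ℕ) : ℝ) * θ = (n + 1) * θ + θ by push_cast; ring,
        Real.cos_sub, Real.cos_add]
      ring
    simp_rw [h1]
    rw [intervalIntegral.integral_div, intervalIntegral.integral_sub, hc n hn, hc (n + 2) (by omega)]
    · simp
    · exact Continuous.intervalIntegrable (by fun_prop) _ _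
    · exact Continuous.intervalIntegrable (by fun_prop) _ _

/-- Expanding in powers of `J`, orthogonality of the sines on `[0, π]` leaves only the term `n = 0`,
hence a value independent of `J`. -/
lemma integral_sin_sq_div {J : ℂ} (hJ : ‖J‖ < 1) :
    ∫ θ in (0 : ℝ)..Real.pi, (Real.sin θ : ℂ) ^ 2 / (1 - 2 * J * Real.cos θ + J ^ 2)
      = (Real.pi / 2 : ℂ) := by
  have h := intervalIntegral.hasSum_integral_of_dominated_convergence (μ := volume)
    (a := 0) (b := Real.pi)
    (F := fun (n : ℕ) (θ : ℝ) => (Real.sin θ : ℂ) * (J ^ n * (Real.sin ((n + 1) * θ) : ℂ)))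
    (f := fun θ : ℝ => (Real.sin θ : ℂ) ^ 2 / (1 - 2 * J * Real.cos θ + J ^ 2))
    (fun n _ => ‖J‖ ^ n) (fun n => Continuous.aestronglyMeasurable (by fun_prop)) ?_ ?_ ?_ ?_
  · have h2 : ∀ n : ℕ, ∫ θ in (0 : ℝ)..Real.pi,
        (Real.sin θ : ℂ) * (J ^ n * (Real.sin ((n + 1) * θ) : ℂ))
        = if n = 0 then (Real.pi / 2 : ℂ) else 0 := by
      intro n
      have h3 : ∀ θ : ℝ, (Real.sin θ : ℂ) * (J ^ n * (Real.sin ((n + 1) * θ) : ℂ))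
          = J ^ n * ((Real.sin θ * Real.sin ((n + 1) * θ) : ℝ) : ℂ) := by
        intro θ; push_cast; ring
      simp_rw [h3]
      rw [intervalIntegral.integral_const_mul, intervalIntegral.integral_ofReal,
        integral_sin_mul_sin_succ]
      split_ifs with hn
      · subst hn; simp
      · simp
    simp_rw [h2] at h
    exact h.unique (hasSum_ite_eq 0 _)
  · intro n
    refine ae_of_all _ fun θ _ => ?_
    rw [norm_mul, norm_mul, norm_pow, Complex.norm_real, Complex.norm_real]
    have h1 := Real.abs_sin_le_one θ
    have h2 := Real.abs_sin_le_one ((n + 1) * θ)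
    rw [Real.norm_eq_abs, Real.norm_eq_abs]
    calc _ ≤ 1 * (‖J‖ ^ n * 1) := by gcongr
      _ = _ := by ring
  · exact ae_of_all _ fun θ _ => summable_geometric_of_lt_one (norm_nonneg _) hJ
  · exact intervalIntegrable_const
  · refine ae_of_all _ fun θ _ => ?_
    have := (hasSum_pow_mul_sin hJ θ).mul_left (Real.sin θ : ℂ)
    convert! this using 1
    ring

/-- The Stieltjes transform of the semicircle. -/
lemma integral_semicircle_div {z : ℂ} (hz : z.im ≠ 0) :
    ∫ t in (-1 : ℝ)..1, (√(1 - t ^ 2) : ℂ) / (t - z) = Real.pi * (tipRoot z - z) := by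
  set J := z - tipRoot z with hJ
  have hJ1 : ‖J‖ < 1 := norm_sub_tipRoot_lt_one hz
  have hJs := tipRoot_sq z
  have hJ0 : J ≠ 0 := by
    intro h
    have : z = tipRoot z := sub_eq_zero.1 h
    rw [← this] at hJs
    have : (1 : ℂ) = 0 := by linear_combination hJs
    exact one_ne_zero this
  -- The Joukowski relation; under `t = cos θ` it turns `t - z` into a multiple of `1 - 2 J cos θ +
  -- J²`.
  have hzJ : 2 * J * z = 1 + J ^ 2 := by rw [hJ]; linear_combination -hJs
  have hne : ∀ t : ℝ, (t : ℂ) - z ≠ 0 := fun t h => hz (by rw [← sub_eq_zero.1 h]; simp)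
  have hsub := intervalIntegral.integral_deriv_smul_comp (a := 0) (b := Real.pi)
    (f := Real.cos) (f' := fun x => -Real.sin x) (g := fun t : ℝ => (√(1 - t ^ 2) : ℂ) / (t - z))
    (fun x _ => Real.hasDerivAt_cos x) (by fun_prop)
    (Continuous.div (by fun_prop) (by fun_prop) hne)
  rw [Real.cos_zero, Real.cos_pi] at hsub
  rw [intervalIntegral.integral_symm, ← hsub, ← intervalIntegral.integral_neg]
  have hpt : ∀ θ ∈ uIcc 0 Real.pi, -(-Real.sin θ • ((fun t : ℝ => (√(1 - t ^ 2) : ℂ) / (t - z)) ∘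
      Real.cos) θ) = (-2 * J) * ((Real.sin θ : ℂ) ^ 2 / (1 - 2 * J * Real.cos θ + J ^ 2)) := by
    intro θ hθ
    rw [uIcc_of_le Real.pi_pos.le] at hθ
    have hs : √(1 - Real.cos θ ^ 2) = Real.sin θ := by
      rw [← Real.sin_sq, Real.sqrt_sq (Real.sin_nonneg_of_mem_Icc hθ)]
    have hd : (1 - 2 * J * Real.cos θ + J ^ 2 : ℂ) = (-2 * J) * (Real.cos θ - z) := by
      linear_combination -hzJ
    have := hne (Real.cos θ)
    simp only [Function.comp, hs, hd, Complex.real_smul]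
    push_cast at *
    field_simp

  rw [intervalIntegral.integral_congr hpt, intervalIntegral.integral_const_mul,
    integral_sin_sq_div hJ1]
  rw [hJ]; ring

/-! ### Cauchy integrals -/

lemma abs_im_le_norm_ofReal_sub (t : ℝ) (z : ℂ) : |z.im| ≤ ‖(t : ℂ) - z‖ := by
  have := Complex.abs_im_le_norm ((t : ℂ) - z)
  simpa using this

lemma ofReal_sub_ne_zero {z : ℂ} (hz : z.im ≠ 0) (t : ℝ) : (t : ℂ) - z ≠ 0 := fun h => by
  have := abs_im_le_norm_ofReal_sub t z
  rw [h, norm_zero] at this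
  exact hz (abs_nonpos_iff.1 this)

section CauchyIntegral

variable {μ : Measure ℝ} {f : ℝ → ℂ} {z : ℂ}

lemma integrable_div_sub_pow (hf : Integrable f μ) (hz : z.im ≠ 0) (n : ℕ) :
    Integrable (fun t => f t / ((t : ℂ) - z) ^ n) μ := by
  have hc : Continuous fun t : ℝ => (((t : ℂ) - z) ^ n)⁻¹ :=
    Continuous.inv₀ (by fun_prop) fun t => pow_ne_zero n (ofReal_sub_ne_zero hz t)
  simp_rw [div_eq_mul_inv]
  refine hf.mul_bdd (c := (|z.im| ^ n)⁻¹) hc.aestronglyMeasurable (ae_of_all _ fun t => ?_)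
  rw [norm_inv, norm_pow]
  have := abs_im_le_norm_ofReal_sub t z
  have h0 : 0 < |z.im| := abs_pos.2 hz
  gcongr

lemma integrable_div_sub (hf : Integrable f μ) (hz : z.im ≠ 0) :
    Integrable (fun t => f t / ((t : ℂ) - z)) μ := by
  simpa using integrable_div_sub_pow hf hz 1

lemma hasDerivAt_integral_div_sub (hf : Integrable f μ) (hz : z.im ≠ 0) :
    HasDerivAt (fun z : ℂ => ∫ t, f t / ((t : ℂ) - z) ∂μ) (∫ t, f t / ((t : ℂ) - z) ^ 2 ∂μ) z := by
  have h0 : 0 < |z.im| := abs_pos.2 hz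
  have hs : Metric.ball z (|z.im| / 2) ∈ 𝓝 z := Metric.ball_mem_nhds _ (by positivity)
  have him : ∀ y ∈ Metric.ball z (|z.im| / 2), |z.im| / 2 ≤ |y.im| := by
    intro y hy
    have h1 : |y.im - z.im| ≤ ‖y - z‖ := by simpa using Complex.abs_im_le_norm (y - z)
    rw [Metric.mem_ball, dist_eq_norm] at hy
    have h2 := abs_sub_abs_le_abs_sub z.im y.im
    rw [abs_sub_comm] at h2
    linarith
  have hne : ∀ y ∈ Metric.ball z (|z.im| / 2), y.im ≠ 0 := fun y hy h => by
    have := him y hy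
    rw [h, abs_zero] at this
    linarith
  refine (hasDerivAt_integral_of_dominated_loc_of_deriv_le (μ := μ)
    (F := fun (z : ℂ) (t : ℝ) => f t / ((t : ℂ) - z))
    (F' := fun (z : ℂ) (t : ℝ) => f t / ((t : ℂ) - z) ^ 2)
    (bound := fun t => ‖f t‖ * ((|z.im| / 2) ^ 2)⁻¹) hs ?_ (integrable_div_sub hf hz)
    (integrable_div_sub_pow hf hz 2).aestronglyMeasurable ?_ (hf.norm.mul_const _) ?_).2
  · filter_upwards [hs] with y hy
    exact (integrable_div_sub hf (hne y hy)).aestronglyMeasurable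
  · refine ae_of_all _ fun t y hy => ?_
    rw [norm_div, norm_pow, div_eq_mul_inv]
    have := (him y hy).trans (abs_im_le_norm_ofReal_sub t y)
    gcongr
  · refine ae_of_all _ fun t y hy => ?_
    have hn := ofReal_sub_ne_zero (hne y hy) t
    have h := ((hasDerivAt_id y).const_sub (t : ℂ)).fun_inv hn
    have h' := h.const_mul (f t)
    simp only [id, neg_neg] at h'
    simpa [div_eq_mul_inv] using h'

end CauchyIntegral

/-! ### The half-Laplacian of `√(1 - t²) / (t - w)` -/

/-- The function `√(1 - t²) / (t - w)` on `[-1, 1]`, extended by zero. -/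
noncomputable def semicircleTest (w : ℂ) (t : ℝ) : ℂ := (√(1 - t ^ 2) : ℂ) / (t - w)

/-- The derivative of the Cauchy integral of `semicircleTest w`. -/
noncomputable def semicircleDeriv (w z : ℂ) : ℂ :=
  Real.pi * (z / tipRoot z / (z - w) - (tipRoot z - tipRoot w) / (z - w) ^ 2)

section Semicircle

variable {w : ℂ}

lemma semicircleTest_eq_zero {t : ℝ} (ht : 1 ≤ |t|) : semicircleTest w t = 0 := by
  have : 1 - t ^ 2 ≤ 0 := by
    rw [← sq_abs]; nlinarith
  rw [semicircleTest, Real.sqrt_eq_zero_of_nonpos this]; simp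

lemma continuous_semicircleTest (hw : w.im ≠ 0) : Continuous (semicircleTest w) :=
  Continuous.div (by fun_prop) (by fun_prop) (ofReal_sub_ne_zero hw)

lemma integrable_semicircleTest (hw : w.im ≠ 0) : Integrable (semicircleTest w) :=
  (continuous_semicircleTest hw).integrable_of_hasCompactSupport
    (hasCompactSupport_of_eq_zero (R := 1) fun _ hx => semicircleTest_eq_zero hx.le)

lemma integral_eq_intervalIntegral_of_eq_zero {f : ℝ → ℂ} (hf : ∀ t, 1 ≤ |t| → f t = 0) :
    ∫ t, f t = ∫ t in (-1 : ℝ)..1, f t := by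
  rw [intervalIntegral.integral_of_le (by norm_num), setIntegral_eq_integral_of_forall_compl_eq_zero]
  intro x hx
  refine hf x ?_
  by_contra h
  rw [not_le, abs_lt] at h
  exact hx ⟨h.1, h.2.le⟩

/-- Partial fractions in `t` reduce this to the semicircle transform at `z` and at `w`. -/
lemma integral_semicircleTest_div (hw : w.im ≠ 0) {z : ℂ} (hz : z.im ≠ 0) (hzw : z ≠ w) :
    ∫ t, semicircleTest w t / ((t : ℂ) - z)
      = Real.pi * ((tipRoot z - tipRoot w) / (z - w) - 1) := by
  have hzw' : z - w ≠ 0 := sub_ne_zero.2 hzw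
  rw [integral_eq_intervalIntegral_of_eq_zero fun t ht => by rw [semicircleTest_eq_zero ht]; simp]
  have h1 : ∀ t : ℝ, semicircleTest w t / ((t : ℂ) - z)
      = ((√(1 - t ^ 2) : ℂ) / (t - z) - (√(1 - t ^ 2) : ℂ) / (t - w)) / (z - w) := by
    intro t
    have n1 := ofReal_sub_ne_zero hz t
    have n2 := ofReal_sub_ne_zero hw t
    rw [semicircleTest]
    field_simp
    ring
  simp_rw [h1]
  rw [intervalIntegral.integral_div, intervalIntegral.integral_sub, integral_semicircle_div hz,
    integral_semicircle_div hw]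
  · field_simp; ring
  · exact (Continuous.div (by fun_prop) (by fun_prop) (ofReal_sub_ne_zero hz)).intervalIntegrable _ _
  · exact (Continuous.div (by fun_prop) (by fun_prop) (ofReal_sub_ne_zero hw)).intervalIntegrable _ _

lemma integral_semicircleTest_div_sq (hw : w.im ≠ 0) {z : ℂ} (hz : z.im ≠ 0) (hzw : z ≠ w) :
    ∫ t, semicircleTest w t / ((t : ℂ) - z) ^ 2 = semicircleDeriv w z := by
  have hzw' : z - w ≠ 0 := sub_ne_zero.2 hzw
  have h1 := hasDerivAt_integral_div_sub (integrable_semicircleTest hw) hz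
  have h2 : HasDerivAt (fun z => (Real.pi : ℂ) * ((tipRoot z - tipRoot w) / (z - w) - 1))
      (Real.pi * (((z / tipRoot z) * (z - w) - (tipRoot z - tipRoot w) * 1) / (z - w) ^ 2)) z :=
    (((((hasDerivAt_tipRoot hz).sub_const (tipRoot w)).div
      ((hasDerivAt_id z).sub_const w) hzw').sub_const 1).const_mul _)
  have hev : (fun z : ℂ => ∫ t, semicircleTest w t / ((t : ℂ) - z)) =ᶠ[𝓝 z]
      fun z => (Real.pi : ℂ) * ((tipRoot z - tipRoot w) / (z - w) - 1) := by
    have o1 : {y : ℂ | y.im ≠ 0} ∈ 𝓝 z :=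
      (isOpen_ne_fun Complex.continuous_im continuous_const).mem_nhds hz
    filter_upwards [o1, isOpen_ne.mem_nhds hzw] with y hy1 hy2
    exact integral_semicircleTest_div hw hy1 hy2
  rw [h1.unique (h2.congr_of_eventuallyEq hev), semicircleDeriv]
  field_simp

/-- The value at `x` of the damped half-Laplacian of `semicircleTest w`. -/
noncomputable def dampedSemicircle (w : ℂ) (η x : ℝ) : ℂ :=
  -(1 / (2 * Real.pi)) *
    (semicircleDeriv w (x + η * Complex.I) + semicircleDeriv w (x - η * Complex.I))

/-- The half-Laplacian of `semicircleTest w`. -/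
noncomputable def semicircleHalfLaplacian (w : ℂ) (x : ℝ) : ℂ :=
  -(1 / 2) * ((x / tipRoot x + (starRingEnd ℂ) (x / tipRoot x)) / (x - w)
    - (tipRoot x + (starRingEnd ℂ) (tipRoot x) - 2 * tipRoot w) / (x - w) ^ 2)

/-- On the cut `tipRoot x` and `x / tipRoot x` are purely imaginary, so the boundary values from
above and below cancel. This cancellation is the reason for the choice of test function. -/
lemma semicircleHalfLaplacian_of_mem_Ioo {x : ℝ} (hx : x ∈ Ioo (-1 : ℝ) 1) :
    semicircleHalfLaplacian w x = -tipRoot w / (x - w) ^ 2 := by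
  rw [semicircleHalfLaplacian, tipRoot_ofReal_of_mem_Ioo hx]
  simp only [map_div₀, map_mul, Complex.conj_I, Complex.conj_ofReal]
  rw [mul_neg, div_neg]
  ring

/-- The kernel at height `η` evaluates the derivative of a Cauchy integral at `x ± iη`. The bound on
`η / a` keeps the rescaled points away from `w`, where the closed form is singular. -/
lemma integral_semicircleTest_dampedKernel (hw : w.im ≠ 0) {a η : ℝ} (ha : 0 < a) (hη : 0 < η)
    (hηw : η / a < |w.im|) (x : ℝ) :
    ∫ y, semicircleTest w (y / a) * dampedKernel η (x - y)
      = (1 / a : ℂ) * dampedSemicircle w (η / a) (x / a) := by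
  have hac : (a : ℂ) ≠ 0 := by exact_mod_cast ha.ne'
  have hscale : ∀ z : ℂ, (z / a).im ≠ 0 → z / a ≠ w →
      ∫ y : ℝ, semicircleTest w (y / a) / ((y : ℂ) - z) ^ 2
        = (1 / a : ℂ) * semicircleDeriv w (z / a) := by
    intro z hz hzw
    rw [← integral_semicircleTest_div_sq hw hz hzw]
    have := Measure.integral_comp_div
      (fun t : ℝ => semicircleTest w t / ((a * t : ℂ) - z) ^ 2) a
    rw [abs_of_pos ha] at this
    have e1 : ∀ y : ℝ, semicircleTest w (y / a) / ((a * ((y / a : ℝ) : ℂ)) - z) ^ 2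
        = semicircleTest w (y / a) / ((y : ℂ) - z) ^ 2 := by
      intro y; push_cast; rw [mul_div_cancel₀ _ hac]
    have e2 : ∀ t : ℝ, semicircleTest w t / ((a * t : ℂ) - z) ^ 2
        = (1 / a ^ 2 : ℂ) * (semicircleTest w t / ((t : ℂ) - z / a) ^ 2) := by
      intro t
      rw [show (a * t : ℂ) - z = a * (t - z / a) by field_simp, mul_pow]
      field_simp
    simp_rw [e1] at this
    rw [this]
    simp_rw [e2]
    rw [integral_const_mul, Complex.real_smul]
    field_simp
  have him : ∀ e : ℝ, |e| = 1 → (((x : ℂ) + e * (η * Complex.I)) / a).im = e * (η / a) := by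
    intro e _
    rw [Complex.div_ofReal_im]
    simp
    ring
  have hgood : ∀ e : ℝ, |e| = 1 → (((x : ℂ) + e * (η * Complex.I)) / a).im ≠ 0 ∧
      ((x : ℂ) + e * (η * Complex.I)) / a ≠ w := by
    intro e he
    have hpos : 0 < η / a := by positivity
    have h1 : |(((x : ℂ) + e * (η * Complex.I)) / a).im| = η / a := by
      rw [him e he, abs_mul, he, one_mul, abs_of_pos hpos]
    constructor
    · rw [← abs_pos, h1]; exact hpos
    · intro h
      rw [h] at h1
      linarith
  have hp := hgood 1 (by simp)
  have hm := hgood (-1) (by simp)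
  simp only [Complex.ofReal_one, Complex.ofReal_neg, one_mul, neg_mul, ← sub_eq_add_neg] at hp hm
  have hint : ∀ z : ℂ, z.im ≠ 0 →
      Integrable fun y : ℝ => semicircleTest w (y / a) / ((y : ℂ) - z) ^ 2 := fun z hz =>
    integrable_div_sub_pow ((integrable_semicircleTest hw).comp_div ha.ne') hz 2
  have hk : ∀ y : ℝ, semicircleTest w (y / a) * dampedKernel η (x - y)
      = -(1 / (2 * Real.pi)) * (semicircleTest w (y / a) / ((y : ℂ) - (x + η * Complex.I)) ^ 2
        + semicircleTest w (y / a) / ((y : ℂ) - (x - η * Complex.I)) ^ 2) := by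
    intro y
    rw [dampedKernel]
    push_cast
    rw [show ((y : ℂ) - (x + η * Complex.I)) ^ 2 = ((x : ℂ) - y + η * Complex.I) ^ 2 by ring,
      show ((y : ℂ) - (x - η * Complex.I)) ^ 2 = ((x : ℂ) - y - η * Complex.I) ^ 2 by ring]
    ring
  simp_rw [hk]
  rw [integral_const_mul, integral_add (hint _ (by simpa using hη.ne'))
    (hint _ (by simpa using hη.ne')), hscale _ hp.1 hp.2, hscale _ hm.1 hm.2, dampedSemicircle]
  push_cast
  rw [show ((x : ℂ) + η * Complex.I) / a = x / a + η / a * Complex.I by ring,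
    show ((x : ℂ) - η * Complex.I) / a = x / a - η / a * Complex.I by ring]
  ring

end Semicircle

/-! ### Removing the damping from the half-Laplacian of the test function. -/

section SemicircleLimit

variable {w : ℂ}

lemma dampedForm_semicircleTest (hw : w.im ≠ 0) {a η : ℝ} (ha : 0 < a) (hη : 0 < η)
    (hηw : η / a < |w.im|) {v : ℝ → ℂ} (hv : Integrable v) :
    dampedForm η v (fun y => semicircleTest w (y / a))
      = ∫ x, dampedSemicircle w (η / a) x * v (a * x) := by
  rw [dampedForm_eq_integral hη hv ((integrable_semicircleTest hw).comp_div ha.ne')]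
  simp_rw [integral_semicircleTest_dampedKernel hw ha hη hηw]
  have h := Measure.integral_comp_div
    (fun x => v (a * x) * ((1 / a : ℂ) * dampedSemicircle w (η / a) x)) a
  rw [abs_of_pos ha] at h
  have hac : (a : ℂ) ≠ 0 := by exact_mod_cast ha.ne'
  simp_rw [mul_div_cancel₀ _ ha.ne'] at h
  rw [h, Complex.real_smul, ← integral_const_mul]
  congr 1; ext x
  field_simp

/-- The singular weight `|x² - 1|^{-1/2}`. -/
noncomputable def tipWeight (x : ℝ) : ℝ := (√|x - 1| * √|x + 1|)⁻¹

lemma measurable_tipWeight : Measurable tipWeight := by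
  unfold tipWeight; fun_prop

lemma locallyIntegrable_inv_sqrt_abs : LocallyIntegrable fun x : ℝ => (√|x|)⁻¹ := by
  refine locallyIntegrable_of_norm_le_rpow (C := 1) (α := 1 / 2) (by simp) (by norm_num)
    (ae_of_all _ fun x => ?_) (by fun_prop)
  rw [one_mul, Real.rpow_neg (norm_nonneg _), Real.norm_eq_abs x, ← Real.sqrt_eq_rpow, norm_inv,
    Real.norm_of_nonneg (Real.sqrt_nonneg _)]

lemma integrableOn_inv_sqrt_abs_sub (c R : ℝ) :
    IntegrableOn (fun x : ℝ => (√|x - c|)⁻¹) (Icc (-R) R) := by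
  rcases le_or_gt (-R) R with h | h
  · have h1 : IntervalIntegrable (fun x : ℝ => (√|x|)⁻¹) volume (-R - c) (R - c) := by
      rw [intervalIntegrable_iff_integrableOn_Icc_of_le (by linarith)]
      exact locallyIntegrable_inv_sqrt_abs.integrableOn_isCompact isCompact_Icc
    have h2 := h1.comp_sub_right c
    simp only [sub_add_cancel] at h2
    exact (intervalIntegrable_iff_integrableOn_Icc_of_le h).1 h2
  · rw [Icc_eq_empty (by linarith)]; exact integrableOn_empty

lemma tipWeight_nonneg (x : ℝ) : 0 ≤ tipWeight x := by unfold tipWeight; positivity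

lemma tipWeight_le (x : ℝ) : tipWeight x ≤ (√|x - 1|)⁻¹ + (√|x + 1|)⁻¹ := by
  have key : ∀ A B : ℝ, 0 ≤ A → 1 ≤ B → (A * B)⁻¹ ≤ A⁻¹ := by
    intro A B hA hB
    rw [mul_inv]
    exact mul_le_of_le_one_right (inv_nonneg.2 hA) (inv_le_one_of_one_le₀ hB)
  have h1 : (0 : ℝ) ≤ (√|x - 1|)⁻¹ := by positivity
  have h2 : (0 : ℝ) ≤ (√|x + 1|)⁻¹ := by positivity
  rw [tipWeight]
  rcases le_total 0 x with h | h
  · have : 1 ≤ √|x + 1| := Real.one_le_sqrt.2 (le_trans (by linarith) (le_abs_self _))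
    linarith [key _ _ (Real.sqrt_nonneg |x - 1|) this]
  · have : 1 ≤ √|x - 1| := Real.one_le_sqrt.2 (le_trans (by linarith) (neg_le_abs _))
    rw [mul_comm]
    linarith [key _ _ (Real.sqrt_nonneg |x + 1|) this]

lemma integrableOn_tipWeight (R : ℝ) : IntegrableOn tipWeight (Icc (-R) R) := by
  have h2 : IntegrableOn (fun x : ℝ => (√|x + 1|)⁻¹) (Icc (-R) R) := by
    simpa using integrableOn_inv_sqrt_abs_sub (-1) R
  refine ((integrableOn_inv_sqrt_abs_sub 1 R).add h2).mono'
    measurable_tipWeight.aestronglyMeasurable (ae_of_all _ fun x => ?_)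
  rw [Real.norm_of_nonneg (tipWeight_nonneg x)]
  exact tipWeight_le x

/-- Leaving the real axis only increases the distances to `±1`, so one locally integrable majorant
serves for every height above the line. -/
lemma inv_norm_tipRoot_le {z : ℂ} (h1 : z.re ≠ 1) (h2 : z.re ≠ -1) :
    ‖tipRoot z‖⁻¹ ≤ tipWeight z.re := by
  have e1 : |z.re - 1| ≤ ‖z - 1‖ := by simpa using Complex.abs_re_le_norm (z - 1)
  have e2 : |z.re + 1| ≤ ‖z + 1‖ := by simpa using Complex.abs_re_le_norm (z + 1)
  have p1 : 0 < |z.re - 1| := abs_pos.2 (sub_ne_zero.2 h1)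
  have p2 : 0 < |z.re + 1| := abs_pos.2 fun h => h2 (by linarith)
  rw [norm_tipRoot, tipWeight]
  gcongr

lemma norm_semicircleDeriv_le {z : ℂ} {d : ℝ} (hd : 0 < d) (hz : d ≤ ‖z - w‖) (h1 : z.re ≠ 1)
    (h2 : z.re ≠ -1) :
    ‖semicircleDeriv w z‖
      ≤ Real.pi * (‖z‖ * tipWeight z.re / d + (‖z‖ + 1 + ‖tipRoot w‖) / d ^ 2) := by
  rw [semicircleDeriv, norm_mul, Complex.norm_real, Real.norm_of_nonneg Real.pi_pos.le]
  refine mul_le_mul_of_nonneg_left ((norm_sub_le _ _).trans (add_le_add ?_ ?_)) Real.pi_pos.le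
  · rw [norm_div, norm_div, div_eq_mul_inv ‖z‖]
    have := inv_norm_tipRoot_le h1 h2
    gcongr
    exact mul_nonneg (norm_nonneg _) (tipWeight_nonneg _)
  · rw [norm_div, norm_pow]
    have := (norm_sub_le (tipRoot z) (tipRoot w)).trans
      (add_le_add_left (norm_tipRoot_le z) ‖tipRoot w‖)
    gcongr

lemma tendsto_tipRoot_add_mul_I (x : ℝ) :
    Tendsto (fun η : ℝ => tipRoot (x + η * Complex.I)) (𝓝[>] 0) (𝓝 (tipRoot x)) := by
  have h : ContinuousWithinAt tipRoot {z | 0 ≤ z.im} (x : ℂ) := continuousOn_tipRoot _ (by simp)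
  refine h.tendsto.comp (tendsto_nhdsWithin_iff.2 ⟨?_, ?_⟩)
  · have : Continuous fun η : ℝ => (x : ℂ) + η * Complex.I := by fun_prop
    simpa using (this.tendsto 0).mono_left nhdsWithin_le_nhds
  · filter_upwards [self_mem_nhdsWithin] with η hη
    simpa using le_of_lt (mem_Ioi.1 hη)

lemma tipRoot_ofReal_ne_zero {x : ℝ} (h1 : x ≠ 1) (h2 : x ≠ -1) : tipRoot x ≠ 0 := by
  intro h
  have h3 := tipRoot_sq x
  rw [h] at h3
  have h4 : ((x : ℂ) - 1) * (x + 1) = 0 := by linear_combination -h3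
  rcases mul_eq_zero.1 h4 with h5 | h5
  · exact h1 (by exact_mod_cast sub_eq_zero.1 h5)
  · exact h2 (by exact_mod_cast eq_neg_of_add_eq_zero_left h5)

lemma tendsto_dampedSemicircle (hw : w.im ≠ 0) {x : ℝ} (h1 : x ≠ 1) (h2 : x ≠ -1) :
    Tendsto (fun η => dampedSemicircle w η x) (𝓝[>] 0) (𝓝 (semicircleHalfLaplacian w x)) := by
  have hs := tendsto_tipRoot_add_mul_I x
  have hs0 := tipRoot_ofReal_ne_zero h1 h2
  have hcs0 : (starRingEnd ℂ) (tipRoot x) ≠ 0 := by simpa using hs0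
  have hxw := ofReal_sub_ne_zero hw x
  have hs' : Tendsto (fun η : ℝ => tipRoot (x - η * Complex.I)) (𝓝[>] 0)
      (𝓝 ((starRingEnd ℂ) (tipRoot x))) := by
    refine ((Complex.continuous_conj.tendsto _).comp hs).congr' ?_
    filter_upwards [self_mem_nhdsWithin] with η hη
    rw [Function.comp, ← tipRoot_conj (by simpa using (mem_Ioi.1 hη).ne')]
    simp [sub_eq_add_neg]
  have hp : Tendsto (fun η : ℝ => (x : ℂ) + η * Complex.I) (𝓝[>] 0) (𝓝 x) := by
    have : Continuous fun η : ℝ => (x : ℂ) + η * Complex.I := by fun_prop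
    simpa using (this.tendsto 0).mono_left nhdsWithin_le_nhds
  have hm : Tendsto (fun η : ℝ => (x : ℂ) - η * Complex.I) (𝓝[>] 0) (𝓝 x) := by
    have : Continuous fun η : ℝ => (x : ℂ) - η * Complex.I := by fun_prop
    simpa using (this.tendsto 0).mono_left nhdsWithin_le_nhds
  have main : ∀ (g : ℝ → ℂ) (r : ℂ), r ≠ 0 → Tendsto g (𝓝[>] 0) (𝓝 x) →
      Tendsto (fun η => tipRoot (g η)) (𝓝[>] 0) (𝓝 r) →
      Tendsto (fun η => semicircleDeriv w (g η)) (𝓝[>] 0)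
        (𝓝 (Real.pi * (x / r / (x - w) - (r - tipRoot w) / (x - w) ^ 2))) := by
    intro g r hr hg hgr
    refine Tendsto.const_mul _ (Tendsto.sub ?_ ?_)
    · exact (hg.div hgr hr).div (hg.sub_const w) hxw
    · exact (hgr.sub_const _).div ((hg.sub_const w).pow 2) (pow_ne_zero 2 hxw)
  have := ((main _ _ hs0 hp hs).add (main _ _ hcs0 hm hs')).const_mul (-(1 / (2 * Real.pi) : ℂ))
  have hpi : (Real.pi : ℂ) ≠ 0 := by exact_mod_cast Real.pi_ne_zero
  have e : semicircleHalfLaplacian w x = -(1 / (2 * Real.pi) : ℂ) *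
      (Real.pi * (x / tipRoot x / (x - w) - (tipRoot x - tipRoot w) / (x - w) ^ 2)
      + Real.pi * (x / (starRingEnd ℂ) (tipRoot x) / (x - w)
        - ((starRingEnd ℂ) (tipRoot x) - tipRoot w) / (x - w) ^ 2)) := by
    rw [semicircleHalfLaplacian, map_div₀, Complex.conj_ofReal]
    field_simp
    ring
  rw [e]
  exact this

lemma continuous_semicircleDeriv_comp {y : ℝ} (hy : y ≠ 0) (hyw : |y| < |w.im|) :
    Continuous fun x : ℝ => semicircleDeriv w (x + y * Complex.I) := by
  have him : ∀ x : ℝ, ((x : ℂ) + y * Complex.I).im ≠ 0 := fun x => by simpa using hy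
  have hne : ∀ x : ℝ, (x : ℂ) + y * Complex.I - w ≠ 0 := fun x h => by
    have : w.im = y := by rw [← sub_eq_zero.1 h]; simp
    rw [this] at hyw
    exact lt_irrefl _ hyw
  have hs : Continuous fun x : ℝ => tipRoot (x + y * Complex.I) :=
    continuous_iff_continuousAt.2 fun x =>
      ContinuousAt.comp (f := fun x : ℝ => (x : ℂ) + y * Complex.I)
        (hasDerivAt_tipRoot (him x)).continuousAt (by fun_prop)
  unfold semicircleDeriv
  refine continuous_const.mul (Continuous.sub ?_ ?_)
  · exact (Continuous.div (by fun_prop) hs fun x => tipRoot_ne_zero (him x)).div (by fun_prop) hne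
  · exact (hs.sub continuous_const).div (by fun_prop) fun x => pow_ne_zero 2 (hne x)

lemma continuous_dampedSemicircle {η : ℝ} (hη : 0 < η) (hηw : η < |w.im|) :
    Continuous (dampedSemicircle w η) := by
  have h1 := continuous_semicircleDeriv_comp (w := w) hη.ne' (by rwa [abs_of_pos hη])
  have h2 := continuous_semicircleDeriv_comp (w := w) (y := -η) (by linarith)
    (by rwa [abs_neg, abs_of_pos hη])
  unfold dampedSemicircle
  refine continuous_const.mul (h1.add ?_)
  convert h2 using 3
  push_cast; ring

lemma norm_dampedSemicircle_le (hw : w.im ≠ 0) {η R x : ℝ} (hη : 0 < η) (hη1 : η < 1)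
    (hηw : η < |w.im| / 2) (hx : |x| ≤ R) (h1 : x ≠ 1) (h2 : x ≠ -1) :
    ‖dampedSemicircle w η x‖ ≤ (R + 1) * tipWeight x / (|w.im| / 2)
      + ((R + 1) + 1 + ‖tipRoot w‖) / (|w.im| / 2) ^ 2 := by
  have hd : 0 < |w.im| / 2 := by have := abs_pos.2 hw; positivity
  have main : ∀ z : ℂ, z.re = x → |z.im| = η → ‖semicircleDeriv w z‖ ≤
      Real.pi * ((R + 1) * tipWeight x / (|w.im| / 2)
      + ((R + 1) + 1 + ‖tipRoot w‖) / (|w.im| / 2) ^ 2) := by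
    intro z hzr hzi
    have hn : ‖z‖ ≤ R + 1 := by
      refine (Complex.norm_le_abs_re_add_abs_im z).trans ?_
      rw [hzr, hzi]; linarith
    have hzw : |w.im| / 2 ≤ ‖z - w‖ := by
      have e1 := Complex.abs_im_le_norm (z - w)
      have e2 := abs_sub_abs_le_abs_sub w.im z.im
      rw [Complex.sub_im, abs_sub_comm] at e1
      linarith
    have := norm_semicircleDeriv_le (w := w) hd hzw (by rwa [hzr]) (by rwa [hzr])
    rw [hzr] at this
    refine this.trans ?_
    have := tipWeight_nonneg x
    gcongr
  have hp := main (x + η * Complex.I) (by simp) (by simp [abs_of_pos hη])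
  have hm := main (x - η * Complex.I) (by simp) (by simp [abs_of_pos hη])
  rw [dampedSemicircle, norm_mul]
  have hpi : ‖(-(1 / (2 * Real.pi)) : ℂ)‖ = 1 / (2 * Real.pi) := by
    rw [norm_neg, show (1 / (2 * Real.pi) : ℂ) = ((1 / (2 * Real.pi) : ℝ) : ℂ) by push_cast; rfl,
      Complex.norm_real, Real.norm_of_nonneg (by positivity)]
  rw [hpi, one_div, inv_mul_le_iff₀ (by positivity)]
  refine (norm_add_le _ _).trans ?_
  linarith

lemma locallyIntegrable_of_forall_integrableOn_Icc {f : ℝ → ℂ}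
    (h : ∀ R : ℝ, IntegrableOn f (Icc (-R) R)) : LocallyIntegrable f := by
  rw [locallyIntegrable_iff]
  intro k hk
  obtain ⟨R, -, hR⟩ := hk.isBounded.exists_pos_norm_lt
  refine (h R).mono_set fun x hx => abs_le.1 ?_
  exact (hR x hx).le

lemma measurable_semicircleHalfLaplacian : Measurable (semicircleHalfLaplacian w) := by
  have hs : Measurable fun x : ℝ => tipRoot x :=
    (continuousOn_tipRoot.comp_continuous Complex.continuous_ofReal fun x => by simp).measurable
  have hc : Measurable (starRingEnd ℂ) := Complex.continuous_conj.measurable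
  have hx : Measurable fun x : ℝ => (x : ℂ) := Complex.measurable_ofReal
  unfold semicircleHalfLaplacian
  refine measurable_const.mul (Measurable.sub ?_ ?_)
  · exact ((hx.div hs).add (hc.comp (hx.div hs))).div (hx.sub measurable_const)
  · exact ((hs.add (hc.comp hs)).sub measurable_const).div ((hx.sub measurable_const).pow_const 2)

lemma ae_ne_one_and_neg_one : ∀ᵐ x : ℝ, x ≠ 1 ∧ x ≠ -1 := by
  have h1 : ∀ᵐ x : ℝ, x ≠ 1 := by simp [ae_iff]
  have h2 : ∀ᵐ x : ℝ, x ≠ -1 := by simp [ae_iff]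
  exact h1.and h2

lemma eventually_damping_small (hw : w.im ≠ 0) :
    ∀ᶠ η : ℝ in 𝓝[>] 0, 0 < η ∧ η < 1 ∧ η < |w.im| / 2 := by
  have hd : 0 < |w.im| / 2 := by have := abs_pos.2 hw; positivity
  filter_upwards [self_mem_nhdsWithin, nhdsWithin_le_nhds (Iio_mem_nhds one_pos),
    nhdsWithin_le_nhds (Iio_mem_nhds hd)] with η h1 h2 h3
  exact ⟨h1, h2, h3⟩

lemma locallyIntegrable_semicircleHalfLaplacian (hw : w.im ≠ 0) :
    LocallyIntegrable (semicircleHalfLaplacian w) := by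
  refine locallyIntegrable_of_forall_integrableOn_Icc fun R => ?_
  refine Integrable.mono' (g := fun x => (R + 1) * tipWeight x / (|w.im| / 2)
      + ((R + 1) + 1 + ‖tipRoot w‖) / (|w.im| / 2) ^ 2) ?_
    measurable_semicircleHalfLaplacian.aestronglyMeasurable ?_
  · exact (((integrableOn_tipWeight R).const_mul _).div_const _).add
      (continuous_const.integrableOn_Icc)
  · filter_upwards [ae_restrict_mem measurableSet_Icc, ae_restrict_of_ae ae_ne_one_and_neg_one]
      with x hx hne
    -- The limit inherits the majorant, which is uniform in the damping.
    refine le_of_tendsto (tendsto_dampedSemicircle hw hne.1 hne.2).norm ?_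
    filter_upwards [eventually_damping_small hw] with η hη
    exact norm_dampedSemicircle_le hw hη.1 hη.2.1 hη.2.2 (abs_le.2 hx) hne.1 hne.2

lemma tendsto_integral_dampedSemicircle (hw : w.im ≠ 0) {v : ℝ → ℂ} (hv : Continuous v)
    (hvs : HasCompactSupport v) :
    Tendsto (fun η => ∫ x, dampedSemicircle w η x * v x) (𝓝[>] 0)
      (𝓝 (∫ x, semicircleHalfLaplacian w x * v x)) := by
  obtain ⟨B, hB⟩ := hv.bounded_above_of_compact_support hvs
  obtain ⟨R, hR0, hR⟩ := hvs.isCompact.isBounded.exists_pos_norm_lt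
  have hB0 : 0 ≤ B := (norm_nonneg _).trans (hB 0)
  set b : ℝ → ℝ := fun x => (R + 1) * tipWeight x / (|w.im| / 2)
      + ((R + 1) + 1 + ‖tipRoot w‖) / (|w.im| / 2) ^ 2 with hb
  have hbi : IntegrableOn b (Icc (-R) R) :=
    (((integrableOn_tipWeight R).const_mul _).div_const _).add (continuous_const.integrableOn_Icc)
  refine tendsto_integral_filter_of_dominated_convergence
    ((Icc (-R) R).indicator fun x => b x * B) ?_ ?_ ?_ ?_
  · filter_upwards [eventually_damping_small hw] with η hη
    have : η < |w.im| := by have := hη.2.2; have := abs_nonneg w.im; linarith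
    exact ((continuous_dampedSemicircle hη.1 this).mul hv).aestronglyMeasurable
  · filter_upwards [eventually_damping_small hw] with η hη
    filter_upwards [ae_ne_one_and_neg_one] with x hne
    by_cases hx : x ∈ Icc (-R) R
    · rw [indicator_of_mem hx, norm_mul]
      have := norm_dampedSemicircle_le hw hη.1 hη.2.1 hη.2.2 (abs_le.2 hx) hne.1 hne.2
      exact mul_le_mul this (hB x) (norm_nonneg _) ((norm_nonneg _).trans this)
    · rw [indicator_of_notMem hx]
      have : v x = 0 := by
        by_contra h
        have := hR x (subset_tsupport v h)
        exact hx (abs_le.1 (by simpa using this.le))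
      rw [this]; simp
  · exact (integrable_indicator_iff measurableSet_Icc).2 (hbi.mul_const B)
  · filter_upwards [ae_ne_one_and_neg_one] with x hne
    exact (tendsto_dampedSemicircle hw hne.1 hne.2).mul_const _

lemma tendsto_dampedForm_semicircleTest (hw : w.im ≠ 0) {a : ℝ} (ha : 0 < a) {v : ℝ → ℂ}
    (hv : Continuous v) (hvs : HasCompactSupport v) :
    Tendsto (fun η => dampedForm η v fun y => semicircleTest w (y / a)) (𝓝[>] 0)
      (𝓝 (∫ x, semicircleHalfLaplacian w x * v (a * x))) := by
  have hvs' : HasCompactSupport fun x => v (a * x) := hvs.comp_homeomorph (Homeomorph.mulLeft₀ a ha.ne')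
  have h := tendsto_integral_dampedSemicircle hw (v := fun x => v (a * x))
    (hv.comp (continuous_const_mul a)) hvs'
  have hdiv : Tendsto (fun η : ℝ => η / a) (𝓝[>] 0) (𝓝[>] 0) := by
    refine tendsto_nhdsWithin_iff.2 ⟨?_, ?_⟩
    · have : Continuous fun η : ℝ => η / a := by fun_prop
      simpa using (this.tendsto 0).mono_left nhdsWithin_le_nhds
    · filter_upwards [self_mem_nhdsWithin] with η hη
      exact div_pos hη ha
  refine (h.comp hdiv).congr' ?_
  filter_upwards [self_mem_nhdsWithin, hdiv.eventually (eventually_damping_small hw)] with η hη hη'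
  rw [Function.comp, dampedForm_semicircleTest hw ha hη ?_ (hv.integrable_of_hasCompactSupport hvs)]
  have := hη'.2.2; have := abs_nonneg w.im; linarith

end SemicircleLimit

/-! ### The Cauchy integral of the weighted pressure -/

section Pressure

variable {E ν : ℝ} {u p : ℝ → ℝ}

lemma sqrt_one_sub_sq {t : ℝ} (ht : t ∈ Ioo (-1 : ℝ) 1) :
    √(1 - t ^ 2) = √(1 + t) / √(1 - t) * (1 - t) := by
  have h1 : 0 < 1 - t := by linarith [ht.2]
  have h2 : √(1 - t) ≠ 0 := (Real.sqrt_pos.2 h1).ne'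
  rw [show 1 - t ^ 2 = (1 + t) * (1 - t) by ring, Real.sqrt_mul (by linarith [ht.1])]
  nth_rw 3 [← Real.mul_self_sqrt h1.le]
  field_simp

lemma integrableOn_sqrt_mul_pressure
    (hp_int : IntegrableOn (fun z => √(1 + z) / √(1 - z) * p z) (Ioo (-1) 1)) :
    IntegrableOn (fun t => √(1 - t ^ 2) * p t) (Ioo (-1) 1) := by
  have h := hp_int.bdd_mul (c := 2) (g := fun t : ℝ => √(1 + t) / √(1 - t) * p t)
    (f := fun t : ℝ => 1 - t) (by fun_prop) (by
      filter_upwards [ae_restrict_mem measurableSet_Ioo] with t ht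
      rw [Real.norm_eq_abs, abs_of_nonneg (by linarith [ht.2])]
      linarith [ht.1])
  refine h.congr ?_
  filter_upwards [ae_restrict_mem measurableSet_Ioo] with t ht
  rw [sqrt_one_sub_sq ht]; ring

/-- Contracting the support only lowers the weight, so the majorant is independent of `a` and is
integrable against `|p|` on `(-1, 1)`. -/
lemma norm_semicircleTest_div_le {w : ℂ} (hw : w.im ≠ 0) {a : ℝ} (ha : 0 < a) (ha1 : a ≤ 1)
    (t : ℝ) : ‖semicircleTest w (t / a)‖ ≤ √(1 - t ^ 2) * |w.im|⁻¹ := by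
  have h0 : 0 < |w.im| := abs_pos.2 hw
  rw [semicircleTest, norm_div, Complex.norm_real, Real.norm_of_nonneg (Real.sqrt_nonneg _),
    div_eq_mul_inv]
  have h1 : t ^ 2 ≤ (t / a) ^ 2 := by
    rw [div_pow, le_div_iff₀ (by positivity)]
    have : a ^ 2 ≤ 1 := by nlinarith
    nlinarith [sq_nonneg t]
  have h2 := abs_im_le_norm_ofReal_sub (t / a) w
  gcongr

/-- The central identity: the pressure law paired with contracted copies of `semicircleTest w`, in
the limit of no contraction. On the other side the contraction appears as a dilation of the argument
of `u`, harmless because `u` is bounded and continuous. -/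
lemma integral_pressure_div_sub (hp : PressureLaw E ν u p) (hu : Continuous u)
    (hu0 : ∀ x, 1 ≤ |x| → u x = 0)
    (hp_int : IntegrableOn (fun z => √(1 + z) / √(1 - z) * p z) (Ioo (-1) 1)) {w : ℂ}
    (hw : w.im ≠ 0) :
    ∫ t in Ioo (-1 : ℝ) 1, ((√(1 - t ^ 2) * p t : ℝ) : ℂ) / (t - w)
      = -((E / (4 * (1 - ν ^ 2)) : ℝ) : ℂ) * tipRoot w * ∫ t, (u t : ℂ) / (t - w) ^ 2 := by
  set c : ℂ := ((E / (4 * (1 - ν ^ 2)) : ℝ) : ℂ) with hc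
  -- Any sequence increasing to `1` in `[1/2, 1)` would do; the lower bound `1/2` confines every `u
  -- (a n * x)` to `|x| ≤ 2`.
  set a : ℕ → ℝ := fun n => 1 - 1 / 2 * (1 / ((n : ℝ) + 1)) with ha
  have hn : ∀ n : ℕ, 0 < 1 / ((n : ℝ) + 1) ∧ 1 / ((n : ℝ) + 1) ≤ 1 := fun n => by
    refine ⟨by positivity, ?_⟩
    rw [div_le_one (by positivity)]; linarith [(Nat.cast_nonneg n : (0 : ℝ) ≤ n)]
  have ha_half : ∀ n, 1 / 2 ≤ a n := fun n => by have := (hn n).2; simp only [ha]; linarith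
  have ha0 : ∀ n, 0 < a n := fun n => by linarith [ha_half n]
  have ha1 : ∀ n, a n < 1 := fun n => by have := (hn n).1; simp only [ha]; linarith
  have halim : Tendsto a atTop (𝓝 1) := by
    have := (tendsto_one_div_add_atTop_nhds_zero_nat (𝕜 := ℝ)).const_mul (1 / 2)
    simpa [ha] using this.const_sub 1
  have hzero : ∀ n x, a n < |x| → semicircleTest w (x / a n) = 0 := fun n x hx =>
    semicircleTest_eq_zero (by
      rw [abs_div, abs_of_pos (ha0 n), le_div_iff₀ (ha0 n), one_mul]; exact hx.le)
  have hid : ∀ n, ∫ x in Ioo (-1 : ℝ) 1, (p x : ℂ) * semicircleTest w (x / a n)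
      = c * ∫ x, semicircleHalfLaplacian w x * (u (a n * x) : ℂ) := by
    intro n
    rw [← hp.integral_mul_eq hu (fun x hx => hu0 x hx.le)
      ((continuous_semicircleTest hw).comp (continuous_id.div_const (a n))) (ha1 n) (hzero n)
      (locallyIntegrable_semicircleHalfLaplacian hw) (ha0 n)
      (fun v hv hvs => tendsto_dampedForm_semicircleTest hw (ha0 n) hv hvs)]
    refine setIntegral_eq_integral_of_forall_compl_eq_zero fun x hx => ?_
    change (p x : ℂ) * semicircleTest w (x / a n) = 0
    rw [hzero n x, mul_zero]
    by_contra h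
    exact hx (abs_lt.1 ((not_lt.1 h).trans_lt (ha1 n)))
  have hpm : AEStronglyMeasurable p (volume.restrict (Ioo (-1) 1)) := by
    refine hp.1.aestronglyMeasurable.mono_measure (Measure.restrict_mono ?_ le_rfl)
    rintro x hx (rfl | h)
    · exact lt_irrefl _ hx.1
    · rw [mem_singleton_iff] at h; exact hx.2.ne h
  have hh := integrableOn_sqrt_mul_pressure hp_int
  have hL : Tendsto (fun n => ∫ x in Ioo (-1 : ℝ) 1, (p x : ℂ) * semicircleTest w (x / a n)) atTop
      (𝓝 (∫ x in Ioo (-1 : ℝ) 1, (p x : ℂ) * semicircleTest w x)) := by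
    refine tendsto_integral_of_dominated_convergence
      (fun t => ‖√(1 - t ^ 2) * p t‖ * |w.im|⁻¹) ?_ (hh.norm.mul_const _) ?_ ?_
    · intro n
      exact (Complex.continuous_ofReal.comp_aestronglyMeasurable hpm).mul
        ((continuous_semicircleTest hw).comp (continuous_id.div_const (a n))).aestronglyMeasurable
    · intro n
      refine ae_of_all _ fun t => ?_
      have := norm_semicircleTest_div_le hw (ha0 n) (ha1 n).le t
      rw [norm_mul, norm_mul, Complex.norm_real, Real.norm_of_nonneg (Real.sqrt_nonneg _)]
      calc _ ≤ ‖p t‖ * (√(1 - t ^ 2) * |w.im|⁻¹) := by gcongr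
        _ = _ := by ring
    · refine ae_of_all _ fun t => Tendsto.const_mul _ ?_
      refine ((continuous_semicircleTest hw).tendsto t).comp ?_
      have := (tendsto_const_nhds (x := t)).div halim one_ne_zero
      rwa [div_one] at this
  obtain ⟨B, hB⟩ := hu.bounded_above_of_compact_support (HasCompactSupport.intro
    (isCompact_Icc (a := -1) (b := 1)) fun x hx => hu0 x (by
      by_contra h; exact hx (abs_le.1 (not_le.1 h).le)))
  have hR := tendsto_integral_mul_of_bounded (R := 2) (B := B)
    (h := semicircleHalfLaplacian w) (f := fun n x => (u (a n * x) : ℂ)) (g := fun x => (u x : ℂ))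
    ((locallyIntegrable_semicircleHalfLaplacian hw).integrableOn_isCompact isCompact_Icc)
    (fun n => by fun_prop) (fun n x => by rw [Complex.norm_real]; exact hB _)
    (fun n x hx => by
      rw [hu0, Complex.ofReal_zero]
      rw [abs_mul, abs_of_pos (ha0 n)]
      nlinarith [ha_half n])
    (fun x => by
      refine (Complex.continuous_ofReal.tendsto _).comp ((hu.tendsto _).comp ?_)
      simpa using halim.mul_const x)
  simp_rw [hid] at hL
  have h := tendsto_nhds_unique hL (hR.const_mul c)
  have e1 : ∀ t : ℝ, ((√(1 - t ^ 2) * p t : ℝ) : ℂ) / (t - w) = (p t : ℂ) * semicircleTest w t := by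
    intro t; rw [semicircleTest]; push_cast; ring
  have e2 : ∫ t, semicircleHalfLaplacian w t * (u t : ℂ)
      = -tipRoot w * ∫ t, (u t : ℂ) / (t - w) ^ 2 := by
    rw [← integral_const_mul]
    congr 1; ext t
    -- Off the fracture `u` vanishes, so only the simple interior formula for the half-Laplacian is
    -- needed.
    by_cases ht : t ∈ Ioo (-1 : ℝ) 1
    · rw [semicircleHalfLaplacian_of_mem_Ioo ht]; ring
    · rw [hu0 t (by by_contra h; exact ht (abs_lt.1 (not_le.1 h)))]; simp
  simp_rw [e1, h, e2]
  ring

end Pressure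

/-! ### Cauchy integrals near the real line -/

/-- Since `|t - (x + iy)| ≥ |t - x|`, the limiting integrand is its own majorant. -/
lemma tendsto_integral_div_sub_pow {μ : Measure ℝ} {f : ℝ → ℂ} {x : ℝ} {n : ℕ}
    (hf : AEStronglyMeasurable f μ) (hint : Integrable (fun t => f t / ((t : ℂ) - x) ^ n) μ)
    (hne : ∀ᵐ t ∂μ, t ≠ x) :
    Tendsto (fun y : ℝ => ∫ t, f t / ((t : ℂ) - (x + y * Complex.I)) ^ n ∂μ) (𝓝[>] 0)
      (𝓝 (∫ t, f t / ((t : ℂ) - x) ^ n ∂μ)) := by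
  refine tendsto_integral_filter_of_dominated_convergence _ ?_ ?_ hint.norm ?_
  · filter_upwards [self_mem_nhdsWithin] with y hy
    have him : ((x : ℂ) + y * Complex.I).im ≠ 0 := by simpa using (mem_Ioi.1 hy).ne'
    have hc : Continuous fun t : ℝ => (((t : ℂ) - (x + y * Complex.I)) ^ n)⁻¹ :=
      Continuous.inv₀ (by fun_prop) fun t => pow_ne_zero n (ofReal_sub_ne_zero him t)
    simp_rw [div_eq_mul_inv]
    exact hf.mul hc.aestronglyMeasurable
  · refine Eventually.of_forall fun y => ?_
    filter_upwards [hne] with t ht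
    rw [norm_div, norm_div, norm_pow, norm_pow]
    have h1 : ‖(t : ℂ) - x‖ ≤ ‖(t : ℂ) - (x + y * Complex.I)‖ := by
      have := Complex.abs_re_le_norm ((t : ℂ) - (x + y * Complex.I))
      rw [← Complex.ofReal_sub, Complex.norm_real, Real.norm_eq_abs]
      simpa using this
    have h2 : 0 < ‖(t : ℂ) - x‖ := norm_pos_iff.2 (sub_ne_zero.2 (by exact_mod_cast ht))
    gcongr
  · filter_upwards [hne] with t ht
    refine Tendsto.div tendsto_const_nhds (Tendsto.pow ?_ n)
      (pow_ne_zero n (sub_ne_zero.2 (by exact_mod_cast ht)))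
    have : Continuous fun y : ℝ => (t : ℂ) - (x + y * Complex.I) := by fun_prop
    simpa using (this.tendsto 0).mono_left nhdsWithin_le_nhds

/-! ### The pressure outside the fracture -/

section Exterior

variable {E ν : ℝ} {u p : ℝ → ℝ}

lemma continuous_dampedKernel {η : ℝ} (hη : 0 < η) : Continuous (dampedKernel η) := by
  have him : ∀ s e : ℝ, e ≠ 0 → (s : ℂ) + e * Complex.I ≠ 0 := fun s e he h => by
    have := congrArg Complex.im h
    simp at this
    exact he this
  have h1 : ∀ s : ℝ, ((s : ℂ) + η * Complex.I) ^ 2 ≠ 0 := fun s => pow_ne_zero 2 (him s η hη.ne')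
  have h2 : ∀ s : ℝ, ((s : ℂ) - η * Complex.I) ^ 2 ≠ 0 := fun s => by
    have := him s (-η) (by linarith)
    push_cast at this
    rw [neg_mul, ← sub_eq_add_neg] at this
    exact pow_ne_zero 2 this
  unfold dampedKernel
  exact continuous_const.mul ((Continuous.div (by fun_prop) (by fun_prop) h2).add
    (Continuous.div (by fun_prop) (by fun_prop) h1))

lemma norm_dampedKernel_le_of_le {η s d : ℝ} (hd : 0 < d)
    (h1 : d ≤ ‖(s : ℂ) + η * Complex.I‖) (h2 : d ≤ ‖(s : ℂ) - η * Complex.I‖) :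
    ‖dampedKernel η s‖ ≤ 1 / (Real.pi * d ^ 2) := by
  have hpi : ‖(-(1 / (2 * Real.pi)) : ℂ)‖ = 1 / (2 * Real.pi) := by
    rw [norm_neg, show (1 / (2 * Real.pi) : ℂ) = ((1 / (2 * Real.pi) : ℝ) : ℂ) by push_cast; rfl,
      Complex.norm_real, Real.norm_of_nonneg (by positivity)]
  rw [dampedKernel, norm_mul, hpi]
  have e : ∀ z : ℂ, d ≤ ‖z‖ → ‖1 / z ^ 2‖ ≤ 1 / d ^ 2 := fun z hz => by
    rw [norm_div, norm_one, norm_pow]; gcongr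
  calc _ ≤ 1 / (2 * Real.pi) * (1 / d ^ 2 + 1 / d ^ 2) := by
        refine mul_le_mul_of_nonneg_left ((norm_add_le _ _).trans (add_le_add ?_ ?_)) (by positivity)
        · exact e _ h2
        · exact e _ h1
    _ = _ := by field_simp; norm_num

lemma norm_dampedKernel_le_damping {η : ℝ} (hη : 0 < η) (s : ℝ) :
    ‖dampedKernel η s‖ ≤ 1 / (Real.pi * η ^ 2) := by
  refine norm_dampedKernel_le_of_le hη ?_ ?_
  · have := Complex.abs_im_le_norm ((s : ℂ) + η * Complex.I)
    simpa [abs_of_pos hη] using this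
  · have := Complex.abs_im_le_norm ((s : ℂ) - η * Complex.I)
    simpa [abs_of_pos hη] using this

/-- Away from the diagonal the bound is uniform in `η`, so the damping can be removed under the
integral; `norm_dampedKernel_le_damping` blows up as `η → 0` and serves only for Fubini. -/
lemma norm_dampedKernel_le {η s d : ℝ} (hd : 0 < d) (hs : d ≤ |s|) :
    ‖dampedKernel η s‖ ≤ 1 / (Real.pi * d ^ 2) := by
  refine norm_dampedKernel_le_of_le hd (hs.trans ?_) (hs.trans ?_)
  · have := Complex.abs_re_le_norm ((s : ℂ) + η * Complex.I)
    simpa using this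
  · have := Complex.abs_re_le_norm ((s : ℂ) - η * Complex.I)
    simpa using this

lemma tendsto_dampedKernel {s : ℝ} (hs : s ≠ 0) :
    Tendsto (fun η => dampedKernel η s) (𝓝[>] 0) (𝓝 (-(1 / Real.pi) * (1 / (s : ℂ) ^ 2))) := by
  have hs' : (s : ℂ) ≠ 0 := by exact_mod_cast hs
  have h1 : Tendsto (fun η : ℝ => (s : ℂ) - η * Complex.I) (𝓝[>] 0) (𝓝 s) := by
    have : Continuous fun η : ℝ => (s : ℂ) - η * Complex.I := by fun_prop
    simpa using (this.tendsto 0).mono_left nhdsWithin_le_nhds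
  have h2 : Tendsto (fun η : ℝ => (s : ℂ) + η * Complex.I) (𝓝[>] 0) (𝓝 s) := by
    have : Continuous fun η : ℝ => (s : ℂ) + η * Complex.I := by fun_prop
    simpa using (this.tendsto 0).mono_left nhdsWithin_le_nhds
  have h := (((tendsto_const_nhds (x := (1 : ℂ))).div (h1.pow 2) (pow_ne_zero 2 hs')).add
    ((tendsto_const_nhds (x := (1 : ℂ))).div (h2.pow 2) (pow_ne_zero 2 hs'))).const_mul
      (-(1 / (2 * Real.pi)) : ℂ)
  have e : (-(1 / Real.pi) * (1 / (s : ℂ) ^ 2) : ℂ)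
      = -(1 / (2 * Real.pi)) * (1 / (s : ℂ) ^ 2 + 1 / (s : ℂ) ^ 2) := by
    field_simp; ring
  rw [e]
  exact h

lemma dampedForm_eq_integral_swap {η : ℝ} (hη : 0 < η) {f g : ℝ → ℂ} (hf : Integrable f)
    (hg : Integrable g) :
    dampedForm η f g = ∫ y, g y * ∫ x, f x * dampedKernel η (x - y) := by
  rw [dampedForm_eq_integral hη hf hg]
  simp_rw [← integral_const_mul]
  rw [integral_integral_swap]
  · congr 1; ext y; congr 1; ext x; ring
  · have hc : Continuous fun q : ℝ × ℝ => dampedKernel η (q.1 - q.2) :=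
      (continuous_dampedKernel hη).comp (continuous_fst.sub continuous_snd)
    have := (hf.mul_prod hg).mul_bdd hc.aestronglyMeasurable
      (ae_of_all _ fun q => norm_dampedKernel_le_damping hη (q.1 - q.2))
    simpa [Function.uncurry_def, mul_assoc] using this

/-- The half-Laplacian of `u` outside the support of `u`. -/
noncomputable def exteriorHalfLaplacian (u : ℝ → ℝ) (x : ℝ) : ℝ :=
  -(1 / Real.pi) * ∫ t, u t / (t - x) ^ 2

lemma continuousOn_exteriorHalfLaplacian (hu : Integrable u) (hu0 : ∀ x, 1 ≤ |x| → u x = 0) :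
    ContinuousOn (exteriorHalfLaplacian u) (Ioi 1) := by
  intro x hx
  refine ContinuousAt.continuousWithinAt ?_
  have hx1 : 0 < (x - 1) / 2 := by have := mem_Ioi.1 hx; linarith
  refine continuousAt_const.mul (continuousAt_of_dominated
    (bound := fun t => ‖u t‖ * (((x - 1) / 2) ^ 2)⁻¹) ?_ ?_ (hu.norm.mul_const _) ?_)
  · refine Eventually.of_forall fun y => ?_
    simp_rw [div_eq_mul_inv]
    exact hu.aestronglyMeasurable.mul (by fun_prop)
  · have : Ioi ((x + 1) / 2) ∈ 𝓝 x := Ioi_mem_nhds (by linarith)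
    filter_upwards [this] with y hy
    refine ae_of_all _ fun t => ?_
    by_cases ht : 1 ≤ |t|
    · rw [hu0 t ht]; simp
    · have ht' := (abs_lt.1 (not_le.1 ht)).2
      have hy' := mem_Ioi.1 hy
      rw [norm_div, norm_pow, div_eq_mul_inv]
      have : (x - 1) / 2 ≤ ‖t - y‖ := by
        rw [Real.norm_eq_abs, abs_sub_comm]
        exact le_trans (by linarith) (le_abs_self _)
      gcongr
  · refine ae_of_all _ fun t => ?_
    by_cases ht : 1 ≤ |t|
    · simp_rw [hu0 t ht, zero_div]; exact continuousAt_const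
    · have ht' := (abs_lt.1 (not_le.1 ht)).2
      have hx' := mem_Ioi.1 hx
      exact ContinuousAt.div (by fun_prop) (by fun_prop) (pow_ne_zero 2 (by linarith))

/-- A compact support in `(1, ∞)` stays a distance `d > 0` from the fracture, so only the kernel off
the diagonal enters, and its limit is `-1 / (π s²)`. -/
lemma halfLaplacian_eq_of_tsupport_subset_Ioi (hu : Integrable u)
    (hu0 : ∀ x, 1 ≤ |x| → u x = 0) (φ : 𝓢(ℝ, ℂ)) (hφ : HasCompactSupport φ)
    (hφs : tsupport φ ⊆ Ioi (1 : ℝ)) :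
    halfLaplacian u φ = ∫ y, φ y * (exteriorHalfLaplacian u y : ℂ) := by
  obtain ⟨d, hd, hdφ⟩ : ∃ d > 0, ∀ y, φ y ≠ 0 → 1 + d ≤ y := by
    rcases (tsupport φ).eq_empty_or_nonempty with h | h
    · refine ⟨1, one_pos, fun y hy => ?_⟩
      have := subset_tsupport φ hy
      rw [h] at this; exact this.elim
    · obtain ⟨m, hm, hle⟩ := hφ.isCompact.exists_isLeast h
      refine ⟨m - 1, by have := mem_Ioi.1 (hφs hm); linarith, fun y hy => ?_⟩
      have := hle (subset_tsupport φ hy)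
      linarith
  have hs : ∀ x y : ℝ, u x ≠ 0 → 1 + d ≤ y → d ≤ |x - y| := fun x y hx hy => by
    have : x < 1 := by
      by_contra h
      exact hx (hu0 x ((not_lt.1 h).trans (le_abs_self x)))
    rw [abs_sub_comm]
    exact le_trans (by linarith) (le_abs_self _)
  have hui : Integrable fun x => (u x : ℂ) := hu.ofReal
  have hφi : Integrable φ := φ.integrable
  refine tendsto_nhds_unique (tendsto_dampedForm_halfLaplacian hu φ) ?_
  have hlim : Tendsto (fun η => ∫ y, φ y * ∫ x, (u x : ℂ) * dampedKernel η (x - y)) (𝓝[>] 0)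
      (𝓝 (∫ y, φ y * (exteriorHalfLaplacian u y : ℂ))) := by
    refine tendsto_integral_filter_of_dominated_convergence
      (fun y => ‖φ y‖ * ∫ x, ‖u x‖ * (1 / (Real.pi * d ^ 2))) ?_ ?_ (hφi.norm.mul_const _) ?_
    · filter_upwards [self_mem_nhdsWithin] with η hη
      refine hφi.aestronglyMeasurable.mul ?_
      have hc : Continuous fun q : ℝ × ℝ => dampedKernel η (q.2 - q.1) :=
        (continuous_dampedKernel hη).comp (continuous_snd.sub continuous_fst)
      have : AEStronglyMeasurable (fun q : ℝ × ℝ => (u q.2 : ℂ) * dampedKernel η (q.2 - q.1))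
          (volume.prod volume) := hui.aestronglyMeasurable.comp_snd.mul hc.aestronglyMeasurable
      exact this.integral_prod_right'
    · refine Eventually.of_forall fun η => ae_of_all _ fun y => ?_
      rw [norm_mul]
      by_cases hy : φ y = 0
      · rw [hy]; simp
      · refine mul_le_mul_of_nonneg_left ?_ (norm_nonneg _)
        refine norm_integral_le_of_norm_le (hu.norm.mul_const _) (ae_of_all _ fun x => ?_)
        rw [norm_mul, Complex.norm_real]
        by_cases hx : u x = 0
        · rw [hx]; simp
        · exact mul_le_mul_of_nonneg_left (norm_dampedKernel_le hd (hs x y hx (hdφ y hy)))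
            (norm_nonneg _)
    · refine ae_of_all _ fun y => ?_
      by_cases hy : φ y = 0
      · simp [hy]
      refine Tendsto.const_mul _ ?_
      have e : (exteriorHalfLaplacian u y : ℂ)
          = ∫ x, (u x : ℂ) * (-(1 / Real.pi) * (1 / ((x - y : ℝ) : ℂ) ^ 2)) := by
        rw [exteriorHalfLaplacian, ← integral_const_mul, ← integral_complex_ofReal]
        congr 1; ext x; push_cast; ring
      rw [e]
      refine tendsto_integral_filter_of_dominated_convergence
        (fun x => ‖u x‖ * (1 / (Real.pi * d ^ 2))) ?_ ?_ (hu.norm.mul_const _) ?_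
      · filter_upwards [self_mem_nhdsWithin] with η hη
        exact hui.aestronglyMeasurable.mul ((continuous_dampedKernel hη).comp
          (continuous_id.sub continuous_const)).aestronglyMeasurable
      · refine Eventually.of_forall fun η => ae_of_all _ fun x => ?_
        rw [norm_mul, Complex.norm_real]
        by_cases hx : u x = 0
        · rw [hx]; simp
        · exact mul_le_mul_of_nonneg_left (norm_dampedKernel_le hd (hs x y hx (hdφ y hy)))
            (norm_nonneg _)
      · refine ae_of_all _ fun x => ?_
        by_cases hx : u x = 0
        · simp [hx]
        refine Tendsto.const_mul _ (tendsto_dampedKernel fun h => ?_)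
        have := hs x y hx (hdφ y hy)
        rw [h, abs_zero] at this
        linarith
  refine hlim.congr' ?_
  filter_upwards [self_mem_nhdsWithin] with η hη
  rw [dampedForm_eq_integral_swap hη hui hφi]

/-- The law gives equality almost everywhere on `(1, ∞)`; continuity of both sides upgrades it to
every point. -/
lemma pressure_eq_exteriorHalfLaplacian (hp : PressureLaw E ν u p) (hu : Integrable u)
    (hu0 : ∀ x, 1 ≤ |x| → u x = 0) (hp_cont : ContinuousOn p (Ioi 1)) {x : ℝ} (hx : 1 < x) :
    p x = E / (4 * (1 - ν ^ 2)) * exteriorHalfLaplacian u x := by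
  set c := E / (4 * (1 - ν ^ 2)) with hc
  have hJ := continuousOn_exteriorHalfLaplacian hu hu0
  have hsub : Ioi (1 : ℝ) ⊆ ({-1, 1}ᶜ : Set ℝ) := by
    rintro y hy (rfl | h)
    · have := mem_Ioi.1 hy; linarith
    · rw [mem_singleton_iff] at h; exact (mem_Ioi.1 hy).ne' h
  have hcJ : ContinuousOn (fun y => c * exteriorHalfLaplacian u y) (Ioi 1) := continuousOn_const.mul hJ
  have hli : LocallyIntegrableOn (fun y => p y - c * exteriorHalfLaplacian u y) (Ioi 1) :=
    (hp_cont.sub hcJ).locallyIntegrableOn measurableSet_Ioi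
  have hae := isOpen_Ioi.ae_eq_zero_of_integral_contDiff_smul_eq_zero hli ?_
  · have h2 : p =ᵐ[volume.restrict (Ioi 1)] fun y => c * exteriorHalfLaplacian u y := by
      rw [Filter.EventuallyEq, ae_restrict_iff' measurableSet_Ioi]
      filter_upwards [hae] with y hy h
      exact sub_eq_zero.1 (hy h)
    exact Measure.eqOn_open_of_ae_eq h2 isOpen_Ioi hp_cont hcJ hx
  · intro g hg hgs hgt
    have hgs' : HasCompactSupport fun y => (g y : ℂ) := hgs.comp_left (g := fun r : ℝ => (r : ℂ)) (by simp)
    set Φ : 𝓢(ℝ, ℂ) := hgs'.toSchwartzMap (Complex.ofRealCLM.contDiff.comp hg) with hΦ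
    have hts : tsupport Φ ⊆ Ioi (1 : ℝ) := by
      refine (closure_mono fun y hy => ?_).trans hgt
      intro h0
      exact hy (by change (g y : ℂ) = 0; rw [h0]; simp)
    have h1 := hp.2 Φ hgs' (hts.trans hsub)
    rw [halfLaplacian_eq_of_tsupport_subset_Ioi hu hu0 Φ hgs' hts] at h1
    have h2 : ∫ y, p y * g y = c * ∫ y, g y * exteriorHalfLaplacian u y := by
      have e1 : ∀ y, (p y : ℂ) * Φ y = ((p y * g y : ℝ) : ℂ) := fun y => by push_cast; rfl
      have e2 : ∀ y, Φ y * (exteriorHalfLaplacian u y : ℂ)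
          = ((g y * exteriorHalfLaplacian u y : ℝ) : ℂ) := fun y => by push_cast; rfl
      simp_rw [e1, e2] at h1
      rw [integral_complex_ofReal, integral_complex_ofReal] at h1
      exact_mod_cast h1
    have hint : ∀ q : ℝ → ℝ, ContinuousOn q (Ioi 1) → Integrable fun y => g y * q y := by
      intro q hq
      rw [← integrableOn_iff_integrable_of_support_subset (s := tsupport g) fun y hy =>
        subset_tsupport g (left_ne_zero_of_mul hy)]
      exact (hg.continuous.continuousOn.mul (hq.mono hgt)).integrableOn_compact hgs
    have e : ∀ y, g y • (p y - c * exteriorHalfLaplacian u y)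
        = g y * p y - c * (g y * exteriorHalfLaplacian u y) := fun y => by
      rw [smul_eq_mul]; ring
    simp_rw [e]
    rw [integral_sub (hint p hp_cont) ((hint _ hJ).const_mul c), integral_const_mul, ← h2]
    simp_rw [mul_comm (g _) (p _), sub_self]

/-- The central identity at `w = x + iy` with `y → 0⁺`: its `u` integral becomes a multiple of `p
x`, and the constant `E / (4 (1 - ν²))` disappears. -/
lemma sqrt_mul_pressure_eq (hp : PressureLaw E ν u p) (hu : Continuous u)
    (hu0 : ∀ x, 1 ≤ |x| → u x = 0) (hp_cont : ContinuousOn p (Ioi 1))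
    (hp_int : IntegrableOn (fun z => √(1 + z) / √(1 - z) * p z) (Ioo (-1) 1)) {x : ℝ}
    (hx : 1 < x) :
    √(x - 1) * √(x + 1) * p x
      = 1 / Real.pi * ∫ t in Ioo (-1 : ℝ) 1, √(1 - t ^ 2) * p t / (t - x) := by
  have hcs : HasCompactSupport u := HasCompactSupport.intro
    (isCompact_Icc (a := -1) (b := 1)) fun x hx => hu0 x (by
      by_contra h; exact hx (abs_le.1 (not_le.1 h).le))
  have hui : Integrable u := hu.integrable_of_hasCompactSupport hcs
  have hh := integrableOn_sqrt_mul_pressure hp_int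
  have hx0 : 0 < x - 1 := by linarith
  have hne1 : ∀ᵐ t ∂(volume.restrict (Ioo (-1 : ℝ) 1)), t ≠ x := by
    filter_upwards [ae_restrict_mem measurableSet_Ioo] with t ht
    exact (ht.2.trans hx).ne
  have hbound : ∀ t : ℝ, t < 1 → x - 1 ≤ ‖(t : ℂ) - x‖ := fun t ht => by
    rw [← Complex.ofReal_sub, Complex.norm_real, Real.norm_eq_abs, abs_sub_comm]
    exact le_trans (by linarith) (le_abs_self _)
  have hm : ∀ n : ℕ, AEStronglyMeasurable (fun t : ℝ => (((t : ℂ) - x) ^ n)⁻¹) volume := fun n =>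
    Measurable.aestronglyMeasurable (by fun_prop)
  have i1 : Integrable (fun t => ((√(1 - t ^ 2) * p t : ℝ) : ℂ) / ((t : ℂ) - x) ^ 1)
      (volume.restrict (Ioo (-1 : ℝ) 1)) := by
    simp_rw [div_eq_mul_inv]
    refine Integrable.mul_bdd (c := ((x - 1) ^ 1)⁻¹) hh.ofReal (hm 1).restrict ?_
    filter_upwards [ae_restrict_mem measurableSet_Ioo] with t ht
    rw [norm_inv, norm_pow]
    have := hbound t ht.2
    gcongr
  have i2 : Integrable (fun t => (u t : ℂ) / ((t : ℂ) - x) ^ 2) := by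
    refine (hui.norm.mul_const ((x - 1) ^ 2)⁻¹).mono' ?_ (ae_of_all _ fun t => ?_)
    · simp_rw [div_eq_mul_inv]
      exact hui.ofReal.aestronglyMeasurable.mul (hm 2)
    · rw [norm_div, norm_pow, Complex.norm_real, div_eq_mul_inv]
      by_cases ht : t < 1
      · have := hbound t ht
        gcongr
      · rw [hu0 t ((not_lt.1 ht).trans (le_abs_self t))]; simp
  have l1 := tendsto_integral_div_sub_pow
    (f := fun t : ℝ => ((√(1 - t ^ 2) * p t : ℝ) : ℂ)) hh.ofReal.aestronglyMeasurable i1 hne1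
  have l2 := tendsto_integral_div_sub_pow (f := fun t : ℝ => (u t : ℂ))
    hui.ofReal.aestronglyMeasurable i2 (by simp [ae_iff])
  have l3 := ((tendsto_tipRoot_add_mul_I x).const_mul
    (-((E / (4 * (1 - ν ^ 2)) : ℝ) : ℂ))).mul l2
  have heq := tendsto_nhds_unique (l1.congr' ?_) l3
  · rw [tipRoot_ofReal_of_one_lt hx] at heq
    have e1 : ∀ t : ℝ, ((√(1 - t ^ 2) * p t : ℝ) : ℂ) / ((t : ℂ) - x) ^ 1
        = ((√(1 - t ^ 2) * p t / (t - x) : ℝ) : ℂ) := fun t => by push_cast; rw [pow_one]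
    have e2 : ∀ t : ℝ, (u t : ℂ) / ((t : ℂ) - x) ^ 2 = ((u t / (t - x) ^ 2 : ℝ) : ℂ) := fun t => by
      push_cast; rfl
    simp_rw [e1, e2] at heq
    rw [integral_complex_ofReal, integral_complex_ofReal] at heq
    have heq' : ∫ t in Ioo (-1 : ℝ) 1, √(1 - t ^ 2) * p t / (t - x)
        = -(E / (4 * (1 - ν ^ 2))) * (√(x - 1) * √(x + 1)) * ∫ t, u t / (t - x) ^ 2 := by
      exact_mod_cast heq
    rw [heq', pressure_eq_exteriorHalfLaplacian hp hui hu0 hp_cont hx, exteriorHalfLaplacian]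
    have := Real.pi_ne_zero
    ring
  · filter_upwards [self_mem_nhdsWithin] with y hy
    have := integral_pressure_div_sub hp hu hu0 hp_int (w := x + y * Complex.I)
      (by simpa using (mem_Ioi.1 hy).ne')
    simpa using this

lemma tendsto_sqrt_mul_pressure (hp : PressureLaw E ν u p) (hu : Continuous u)
    (hu0 : ∀ x, 1 ≤ |x| → u x = 0) (hp_cont : ContinuousOn p (Ioi 1))
    (hp_int : IntegrableOn (fun z => √(1 + z) / √(1 - z) * p z) (Ioo (-1) 1)) :
    Tendsto (fun x => -√(x - 1) * p x) (𝓝[>] 1)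
      (𝓝 (1 / (Real.pi * √2) * ∫ z in Ioo (-1 : ℝ) 1, √(1 + z) / √(1 - z) * p z)) := by
  have hh := integrableOn_sqrt_mul_pressure hp_int
  have hlim : Tendsto (fun x => ∫ t in Ioo (-1 : ℝ) 1, √(1 - t ^ 2) * p t / (t - x)) (𝓝[>] 1)
      (𝓝 (∫ t in Ioo (-1 : ℝ) 1, √(1 - t ^ 2) * p t / (t - 1))) := by
    refine tendsto_integral_filter_of_dominated_convergence
      (fun t => ‖√(1 + t) / √(1 - t) * p t‖) ?_ ?_ hp_int.norm ?_
    · refine Eventually.of_forall fun x => ?_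
      simp_rw [div_eq_mul_inv]
      exact hh.aestronglyMeasurable.mul (by fun_prop)
    · filter_upwards [self_mem_nhdsWithin] with x hx
      filter_upwards [ae_restrict_mem measurableSet_Ioo] with t ht
      have h1 : 0 < 1 - t := by linarith [ht.2]
      -- Replacing `x` by the tip only shrinks the denominator; this turns the assumed integrability
      -- into domination uniform in `x`.
      have h2 : 1 - t ≤ ‖t - x‖ := by
        rw [Real.norm_eq_abs, abs_sub_comm]
        exact le_trans (by have := mem_Ioi.1 hx; linarith) (le_abs_self _)
      rw [sqrt_one_sub_sq ht, norm_div, div_le_iff₀ (h1.trans_le h2), mul_right_comm, norm_mul,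
        Real.norm_of_nonneg h1.le]
      gcongr
    · filter_upwards [ae_restrict_mem measurableSet_Ioo] with t ht
      refine Tendsto.div tendsto_const_nhds ?_ (by linarith [ht.2])
      exact (tendsto_const_nhds.sub tendsto_id).mono_left nhdsWithin_le_nhds
  have hsq : Tendsto (fun x : ℝ => -(1 / Real.pi) / √(x + 1)) (𝓝[>] 1)
      (𝓝 (-(1 / Real.pi) / √2)) := by
    have : ContinuousAt (fun x : ℝ => -(1 / Real.pi) / √(x + 1)) 1 :=
      ContinuousAt.div (by fun_prop) (by fun_prop) (by norm_num)
    have h := this.tendsto.mono_left (nhdsWithin_le_nhds (s := Ioi 1))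
    norm_num at h ⊢
    exact h
  have hval : ∫ t in Ioo (-1 : ℝ) 1, √(1 - t ^ 2) * p t / (t - 1)
      = -∫ z in Ioo (-1 : ℝ) 1, √(1 + z) / √(1 - z) * p z := by
    rw [← integral_neg]
    refine setIntegral_congr_fun measurableSet_Ioo fun t ht => ?_
    have h1 : t - 1 ≠ 0 := by linarith [ht.2]
    have h2 : √(1 - t) ≠ 0 := (Real.sqrt_pos.2 (by linarith [ht.2])).ne'
    rw [sqrt_one_sub_sq ht]
    field_simp
    ring
  have h := hsq.mul hlim
  rw [hval] at h
  have hs2 : √2 ≠ 0 := by norm_num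
  have e : 1 / (Real.pi * √2) * ∫ z in Ioo (-1 : ℝ) 1, √(1 + z) / √(1 - z) * p z
      = -(1 / Real.pi) / √2 * -∫ z in Ioo (-1 : ℝ) 1, √(1 + z) / √(1 - z) * p z := by
    field_simp
  rw [e]
  refine h.congr' ?_
  filter_upwards [self_mem_nhdsWithin] with x hx
  have hx1 := mem_Ioi.1 hx
  have := sqrt_mul_pressure_eq hp hu hu0 hp_cont hp_int hx1
  have h2 : √(x + 1) ≠ 0 := (Real.sqrt_pos.2 (by linarith)).ne'
  rw [div_mul_eq_mul_div, neg_mul, ← this]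
  field_simp

end Exterior

/-! ### Hölder continuity up to the tip -/

section HolderTip

variable {p : ℝ → ℝ}

/-- On an interval of length at most `1` the exponent may be lowered. Exponents below `1` are what
makes `(1 + q²)^((s - 2) / 2)` integrable in the boundary estimate. -/
lemma exists_holder_exponent_lt_one {f : ℝ → ℝ} {x₀ : ℝ} (hx₀ : x₀ < 1) {C r : ℝ≥0} (hr : 0 < r)
    (hf : HolderOnWith C r f (Ioo x₀ 1)) :
    ∃ x₁ s : ℝ, 0 ≤ x₁ ∧ x₁ < 1 ∧ 0 < s ∧ s < 1 ∧
      ∀ x ∈ Ioo x₁ 1, ∀ y ∈ Ioo x₁ 1, |f x - f y| ≤ C * |x - y| ^ s := by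
  refine ⟨max x₀ 0, min r (1 / 2), le_max_right _ _, max_lt hx₀ one_pos,
    lt_min (by exact_mod_cast hr) (by norm_num), (min_le_right _ _).trans_lt (by norm_num), ?_⟩
  intro x hx y hy
  have h := hf.dist_le ⟨(le_max_left _ _).trans_lt hx.1, hx.2⟩
    ⟨(le_max_left _ _).trans_lt hy.1, hy.2⟩
  rw [Real.dist_eq, Real.dist_eq] at h
  refine h.trans (mul_le_mul_of_nonneg_left ?_ C.2)
  have hx0 := (le_max_right x₀ 0).trans_lt hx.1
  have hy0 := (le_max_right x₀ 0).trans_lt hy.1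
  have h1 : |x - y| ≤ 1 := by rw [abs_le]; constructor <;> linarith [hx.2, hy.2]
  rcases (abs_nonneg (x - y)).eq_or_lt with h0 | h0
  · rw [← h0, Real.zero_rpow (by exact_mod_cast hr.ne'), Real.zero_rpow]
    exact (lt_min (by exact_mod_cast hr) (by norm_num) : (0 : ℝ) < min (r : ℝ) (1 / 2)).ne'
  · exact Real.rpow_le_rpow_of_exponent_ge h0 h1 (min_le_left _ _)

/-- If the bound failed at `x`, the Hölder condition would keep `|f|` above a positive constant on
`(x, 1)`, and `1 / (1 - t)` would be integrable there. So `f` tends to `0` at the tip, at the Hölder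
rate. -/
lemma abs_le_of_integrableOn_div {f : ℝ → ℝ} {x₁ C s : ℝ} (hC : 0 ≤ C) (hs : 0 < s) (hx₁ : -1 ≤ x₁)
    (hf : ∀ x ∈ Ioo x₁ 1, ∀ y ∈ Ioo x₁ 1, |f x - f y| ≤ C * |x - y| ^ s)
    (hint : IntegrableOn (fun t => f t / (1 - t)) (Ioo (-1) 1)) {x : ℝ} (hx : x ∈ Ioo x₁ 1) :
    |f x| ≤ C * (1 - x) ^ s := by
  by_contra hcon
  rw [not_le] at hcon
  set d := |f x| - C * (1 - x) ^ s with hd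
  have hd0 : 0 < d := by simp only [hd]; linarith
  have hlow : ∀ t ∈ Ioo x 1, d ≤ |f t| := by
    intro t ht
    have h1 := hf x hx t ⟨hx.1.trans ht.1, ht.2⟩
    have h2 : |x - t| ^ s ≤ (1 - x) ^ s := by
      refine Real.rpow_le_rpow (abs_nonneg _) ?_ hs.le
      rw [abs_sub_comm, abs_of_pos (by linarith [ht.1])]
      linarith [ht.2]
    have h3 := abs_sub_abs_le_abs_sub (f x) (f t)
    have h4 := mul_le_mul_of_nonneg_left h2 hC
    linarith
  have hI : IntegrableOn (fun t : ℝ => (t - 1)⁻¹) (Ioo x 1) := by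
    have h1 : IntegrableOn (fun t => f t / (1 - t)) (Ioo x 1) :=
      hint.mono_set (Ioo_subset_Ioo_left (by linarith [hx.1]))
    refine (h1.norm.const_mul d⁻¹).mono' (by fun_prop) ?_
    filter_upwards [ae_restrict_mem measurableSet_Ioo] with t ht
    have h2 : 0 < 1 - t := by linarith [ht.2]
    rw [norm_div, norm_inv, Real.norm_of_nonneg h2.le, Real.norm_eq_abs, Real.norm_eq_abs,
      abs_sub_comm, abs_of_pos h2, ← one_div, ← mul_div_assoc]
    gcongr
    rw [le_inv_mul_iff₀ hd0, mul_one]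
    exact hlow t ht
  have h2 : IntervalIntegrable (fun t : ℝ => (t - 1)⁻¹) volume x 1 := by
    rw [intervalIntegrable_iff_integrableOn_Ioo_of_le hx.2.le]; exact hI
  rcases intervalIntegrable_sub_inv_iff.1 h2 with h3 | h3
  · exact hx.2.ne h3
  · exact h3 right_mem_uIcc

/-- Multiplying by the Lipschitz factor `√(1 + z)` preserves the Hölder bound. The endpoint `1` can
be included because the function tends to `0` there, and its formal value at `1` is `0` whatever `p
1` is. -/
lemma exists_holder_sqrt_mul_pressure {x₀ : ℝ} (hx₀ : x₀ < 1) {C r : ℝ≥0} (hr : 0 < r)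
    (hf : HolderOnWith C r (fun z => √(1 - z) * p z) (Ioo x₀ 1))
    (hp_int : IntegrableOn (fun z => √(1 + z) / √(1 - z) * p z) (Ioo (-1) 1)) :
    ∃ x₁ s D : ℝ, 0 ≤ x₁ ∧ x₁ < 1 ∧ 0 < s ∧ s < 1 ∧ 0 ≤ D ∧
      ∀ x ∈ Ioc x₁ 1, ∀ y ∈ Ioc x₁ 1,
        |√(1 - x ^ 2) * p x - √(1 - y ^ 2) * p y| ≤ D * |x - y| ^ s := by
  obtain ⟨x₁, s, h0, h1, hs0, hs1, hH⟩ := exists_holder_exponent_lt_one hx₀ hr hf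
  set g : ℝ → ℝ := fun z => √(1 - z) * p z with hg
  have hC : (0 : ℝ) ≤ C := C.2
  refine ⟨x₁, s, 3 * C, h0, h1, hs0, hs1, by positivity, ?_⟩
  have hint : IntegrableOn (fun t => (√(1 + t) * g t) / (1 - t)) (Ioo (-1) 1) := by
    refine hp_int.congr ?_
    filter_upwards [ae_restrict_mem measurableSet_Ioo] with t ht
    have h2 : 0 < 1 - t := by linarith [ht.2]
    have h3 : √(1 - t) ≠ 0 := (Real.sqrt_pos.2 h2).ne'
    simp only [hg]
    rw [div_mul_eq_mul_div, div_eq_div_iff h3 h2.ne']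
    nth_rw 1 [← Real.mul_self_sqrt h2.le]
    ring
  have hint' : IntegrableOn (fun t => g t / (1 - t)) (Ioo (max x₁ 0) 1) := by
    have h2 : IntegrableOn (fun t => (√(1 + t) * g t) / (1 - t)) (Ioo (max x₁ 0) 1) :=
      hint.mono_set (Ioo_subset_Ioo_left (by linarith [le_max_right x₁ 0]))
    -- A globally bounded substitute for `1 / √(1 + t)`, equal to it for `t ≥ 0`.
    have hinv : Continuous fun t : ℝ => (√(max (1 + t) 1))⁻¹ :=
      Continuous.inv₀ (by fun_prop) fun t =>
        (Real.sqrt_pos.2 (lt_of_lt_of_le one_pos (le_max_right _ _))).ne'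
    have h3 := h2.bdd_mul (c := 1) hinv.aestronglyMeasurable (ae_of_all _ fun t => by
      rw [norm_inv, Real.norm_of_nonneg (Real.sqrt_nonneg _)]
      exact inv_le_one_of_one_le₀ (Real.one_le_sqrt.2 (le_max_right _ _)))
    refine h3.congr ?_
    filter_upwards [ae_restrict_mem measurableSet_Ioo] with t ht
    have ht0 : 0 < t := (le_max_right _ _).trans_lt ht.1
    rw [max_eq_left (by linarith)]
    have : √(1 + t) ≠ 0 := (Real.sqrt_pos.2 (by linarith)).ne'
    field_simp
  have hgb : ∀ x ∈ Ioo x₁ 1, |g x| ≤ C * (1 - x) ^ s := by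
    intro x hx
    -- Without the factor `√(1 + t)` integrability near `-1` is not available, so `g` is cut off to
    -- a neighbourhood of the right tip.
    have hi : IntegrableOn (fun t => (Ioo (max x₁ 0) 1).indicator g t / (1 - t)) (Ioo (-1) 1) := by
      have e : (fun t => (Ioo (max x₁ 0) 1).indicator g t / (1 - t))
          = (Ioo (max x₁ 0) 1).indicator fun t => g t / (1 - t) := by
        ext t; by_cases ht : t ∈ Ioo (max x₁ 0) 1 <;> simp [ht]
      rw [e]
      exact ((integrable_indicator_iff measurableSet_Ioo).2 hint').integrableOn
    have hmax : max x₁ 0 = x₁ := max_eq_left h0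
    rw [hmax] at hi
    have := abs_le_of_integrableOn_div (f := (Ioo x₁ 1).indicator g) hC hs0 (by linarith)
      (fun x hx y hy => by
        rw [indicator_of_mem hx, indicator_of_mem hy]; exact hH x hx y hy) hi hx
    rwa [indicator_of_mem hx] at this
  set h : ℝ → ℝ := fun z => √(1 - z ^ 2) * p z with hh
  have hhg : ∀ x ∈ Ioo x₁ 1, h x = √(1 + x) * g x := by
    intro x hx
    simp only [hh, hg]
    rw [show 1 - x ^ 2 = (1 + x) * (1 - x) by ring, Real.sqrt_mul (by linarith [hx.1]), mul_assoc]
  have hh1 : h 1 = 0 := by simp [hh]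
  have hsq : ∀ x ∈ Ioo x₁ 1, √(1 + x) ≤ 2 := by
    intro x hx
    rw [Real.sqrt_le_left (by norm_num)]; linarith [hx.2]
  have htip : ∀ x ∈ Ioc x₁ 1, |h x - h 1| ≤ 3 * C * |x - 1| ^ s := by
    intro x hx
    rcases hx.2.eq_or_lt with he | hlt
    · rw [he, sub_self, abs_zero]; positivity
    · have hx' : x ∈ Ioo x₁ 1 := ⟨hx.1, hlt⟩
      rw [hh1, sub_zero, hhg x hx', abs_mul, abs_of_nonneg (Real.sqrt_nonneg _), abs_sub_comm,
        abs_of_pos (show 0 < 1 - x by linarith)]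
      have h2 : 0 ≤ C * (1 - x) ^ s := mul_nonneg hC (Real.rpow_nonneg (by linarith) _)
      calc _ ≤ 2 * (C * (1 - x) ^ s) :=
            mul_le_mul (hsq x hx') (hgb x hx') (abs_nonneg _) (by norm_num)
        _ ≤ _ := by linarith
  intro x hx y hy
  change |h x - h y| ≤ _
  rcases hx.2.eq_or_lt with hx1 | hx1
  · rw [hx1, abs_sub_comm, abs_sub_comm 1 y]; exact htip y hy
  rcases hy.2.eq_or_lt with hy1 | hy1
  · rw [hy1]; exact htip x hx
  have hx' : x ∈ Ioo x₁ 1 := ⟨hx.1, hx1⟩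
  have hy' : y ∈ Ioo x₁ 1 := ⟨hy.1, hy1⟩
  have hxy : |x - y| ≤ 1 := by rw [abs_le]; constructor <;> linarith [hx.1, hy.1]
  have hpow : |x - y| ≤ |x - y| ^ s := by
    simpa using Real.rpow_le_rpow_of_exponent_ge_of_imp (abs_nonneg _) hxy hs1.le
      (fun _ h => absurd h one_ne_zero)
  have hsqrt : |√(1 + x) - √(1 + y)| ≤ |x - y| := by
    have a1 : 1 ≤ √(1 + x) := Real.one_le_sqrt.2 (by linarith [hx.1])
    have a2 : 1 ≤ √(1 + y) := Real.one_le_sqrt.2 (by linarith [hy.1])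
    have e : x - y = (√(1 + x) - √(1 + y)) * (√(1 + x) + √(1 + y)) := by
      have b1 := Real.mul_self_sqrt (show 0 ≤ 1 + x by linarith [hx.1])
      have b2 := Real.mul_self_sqrt (show 0 ≤ 1 + y by linarith [hy.1])
      linear_combination -b1 + b2
    rw [e, abs_mul]
    refine le_mul_of_one_le_right (abs_nonneg _) ?_
    exact le_trans (by linarith) (le_abs_self _)
  have hgy : |g y| ≤ C := by
    refine (hgb y hy').trans (mul_le_of_le_one_right hC ?_)
    exact Real.rpow_le_one (by linarith) (by linarith [hy.1]) hs0.le
  rw [hhg x hx', hhg y hy', show √(1 + x) * g x - √(1 + y) * g y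
    = √(1 + x) * (g x - g y) + (√(1 + x) - √(1 + y)) * g y by ring]
  refine (abs_add_le _ _).trans ?_
  rw [abs_mul, abs_mul, abs_of_nonneg (Real.sqrt_nonneg _)]
  calc _ ≤ 2 * (C * |x - y| ^ s) + |x - y| ^ s * C := by
        refine add_le_add ?_ ?_
        · exact mul_le_mul (hsq x hx') (hH x hx' y hy') (abs_nonneg _) (by norm_num)
        · exact mul_le_mul (hsqrt.trans hpow) hgy (abs_nonneg _) (Real.rpow_nonneg (abs_nonneg _) _)
    _ = _ := by ring

end HolderTip

/-! ### Boundary values of the Cauchy integral of a Hölder function -/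

section BoundaryValue

variable {h : ℝ → ℝ} {x₁ s D : ℝ}

/-- The Cauchy integral of `h` over `(-1, 1)`. -/
noncomputable def cauchyIntegral (h : ℝ → ℝ) (z : ℂ) : ℂ :=
  ∫ t in Ioo (-1 : ℝ) 1, (h t : ℂ) / (t - z)

/-- The derivative of `cauchyIntegral h`. -/
noncomputable def cauchyIntegralDeriv (h : ℝ → ℝ) (z : ℂ) : ℂ :=
  ∫ t in Ioo (-1 : ℝ) 1, (h t : ℂ) / (t - z) ^ 2

lemma hasDerivAt_cauchyIntegral (hh : IntegrableOn h (Ioo (-1) 1)) {z : ℂ} (hz : z.im ≠ 0) :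
    HasDerivAt (cauchyIntegral h) (cauchyIntegralDeriv h z) z :=
  hasDerivAt_integral_div_sub (f := fun t => (h t : ℂ)) hh.ofReal hz

lemma continuousOn_cauchyIntegralDeriv (hh : IntegrableOn h (Ioo (-1) 1)) :
    ContinuousOn (cauchyIntegralDeriv h) {z | z.im ≠ 0} := by
  have ho : IsOpen {z : ℂ | z.im ≠ 0} := isOpen_ne_fun Complex.continuous_im continuous_const
  have hd : DifferentiableOn ℂ (cauchyIntegral h) {z | z.im ≠ 0} := fun z hz =>
    (hasDerivAt_cauchyIntegral hh hz).differentiableAt.differentiableWithinAt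
  exact (hd.deriv ho).continuousOn.congr fun z hz => (hasDerivAt_cauchyIntegral hh hz).deriv.symm

lemma integral_one_div_sub_sq {z : ℂ} (hz : z.im ≠ 0) :
    ∫ t in Ioo (-1 : ℝ) 1, 1 / ((t : ℂ) - z) ^ 2 = -(1 / (1 - z)) + 1 / (-1 - z) := by
  rw [← integral_Ioc_eq_integral_Ioo, ← intervalIntegral.integral_of_le (by norm_num),
    intervalIntegral.integral_eq_sub_of_hasDerivAt (f := fun t : ℝ => -(1 / ((t : ℂ) - z)))]
  · push_cast; ring
  · intro t _
    have hn := ofReal_sub_ne_zero hz t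
    have h1 : HasDerivAt (fun y : ℂ => -(1 / (y - z))) (1 / ((t : ℂ) - z) ^ 2) (t : ℂ) := by
      have := (((hasDerivAt_id (t : ℂ)).sub_const z).fun_inv hn).fun_neg
      simp only [id, neg_div, neg_neg] at this
      simpa [one_div] using this
    exact h1.comp_ofReal
  · exact (Continuous.div (by fun_prop) (by fun_prop) fun t =>
      pow_ne_zero 2 (ofReal_sub_ne_zero hz t)).intervalIntegrable _ _

lemma integrable_rpow_sq_add_sq (hs1 : s < 1) :
    Integrable fun q : ℝ => (1 + q ^ 2) ^ ((s - 2) / 2) := by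
  have := integrable_rpow_neg_one_add_norm_sq (E := ℝ) (μ := volume) (r := 2 - s)
    (by simp; linarith)
  simpa [neg_sub] using this

lemma rpow_sq_add_sq_eq {x y t : ℝ} (hy : 0 < y) :
    ((t - x) ^ 2 + y ^ 2) ^ ((s - 2) / 2)
      = y ^ (s - 2) * (1 + ((t - x) / y) ^ 2) ^ ((s - 2) / 2) := by
  have e : (t - x) ^ 2 + y ^ 2 = y ^ 2 * (1 + ((t - x) / y) ^ 2) := by field_simp; ring
  rw [e, Real.mul_rpow (by positivity) (by positivity), ← Real.rpow_natCast y 2, ← Real.rpow_mul hy.le]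
  congr 2
  push_cast; ring

lemma integrable_rpow_sq_add_sq_shift (hs1 : s < 1) {x y : ℝ} (hy : 0 < y) :
    Integrable fun t : ℝ => ((t - x) ^ 2 + y ^ 2) ^ ((s - 2) / 2) := by
  simp_rw [rpow_sq_add_sq_eq hy]
  exact (((integrable_rpow_sq_add_sq hs1).comp_div hy.ne').comp_sub_right x).const_mul _

lemma integral_rpow_sq_add_sq_shift {x y : ℝ} (hy : 0 < y) :
    ∫ t : ℝ, ((t - x) ^ 2 + y ^ 2) ^ ((s - 2) / 2)
      = y ^ (s - 1) * ∫ q : ℝ, (1 + q ^ 2) ^ ((s - 2) / 2) := by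
  simp_rw [rpow_sq_add_sq_eq hy]
  rw [integral_const_mul, integral_sub_right_eq_self
    (fun t : ℝ => (1 + (t / y) ^ 2) ^ ((s - 2) / 2)) x,
    Measure.integral_comp_div (fun q : ℝ => (1 + q ^ 2) ^ ((s - 2) / 2)) y, abs_of_pos hy,
    smul_eq_mul, ← mul_assoc]
  congr 1
  rw [show s - 1 = s - 2 + 1 by ring, Real.rpow_add hy, Real.rpow_one]

/-- Subtracting `h x` leaves an integrand of size `|t - w|^(s - 2)` near `x`, whose integral scales
like `y^(s - 1)`. The subtracted constant produces a pole at the tip, which `|h x| ≤ D (1 - x)^s`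
tames; hence the uniformity up to `x = 1`. -/
lemma exists_norm_cauchyIntegralDeriv_le (hh : IntegrableOn h (Ioo (-1) 1)) (h0 : 0 ≤ x₁)
    (h1 : x₁ < 1) (hs0 : 0 < s) (hs1 : s < 1) (hD : 0 ≤ D)
    (hH : ∀ x ∈ Ioc x₁ 1, ∀ y ∈ Ioc x₁ 1, |h x - h y| ≤ D * |x - y| ^ s) (htip : h 1 = 0) :
    ∃ B, 0 ≤ B ∧ ∀ x ∈ Icc ((x₁ + 1) / 2) 1, ∀ y ∈ Ioc (0 : ℝ) 1,
      ‖cauchyIntegralDeriv h (x + y * Complex.I)‖ ≤ B * y ^ (s - 1) := by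
  -- The distance from the evaluation range `[(x₁ + 1) / 2, 1]` to the region `t ≤ x₁`, where no
  -- Hölder bound is known.
  set d := (1 - x₁) / 2 with hd
  have hd0 : 0 < d := by simp only [hd]; linarith
  set A := ∫ q : ℝ, (1 + q ^ 2) ^ ((s - 2) / 2) with hA
  have hA0 : 0 ≤ A := integral_nonneg fun q => by positivity
  set M := ∫ t in Ioo (-1 : ℝ) 1, (|h t| + D) * (d ^ 2)⁻¹ with hM
  have hM0 : 0 ≤ M := integral_nonneg fun q => by positivity
  refine ⟨D * A + M + 2 * D, by positivity, fun x hx y hy => ?_⟩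
  set w : ℂ := x + y * Complex.I with hw
  have hwim : w.im = y := by simp [hw]
  have hwre : w.re = x := by simp [hw]
  have hw0 : w.im ≠ 0 := by rw [hwim]; exact hy.1.ne'
  have hx1 : x ∈ Ioc x₁ 1 := ⟨lt_of_lt_of_le (by linarith) hx.1, hx.2⟩
  have hy1 : 1 ≤ y ^ (s - 1) := Real.one_le_rpow_of_pos_of_le_one_of_nonpos hy.1 hy.2 (by linarith)
  have hhx : |h x| ≤ D * (1 - x) ^ s := by
    have := hH x hx1 1 ⟨h1, le_rfl⟩
    rwa [htip, sub_zero, abs_sub_comm, abs_of_nonneg (show 0 ≤ 1 - x by linarith [hx.2])] at this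
  have hhx' : |h x| ≤ D := by
    refine hhx.trans (mul_le_of_le_one_right hD ?_)
    exact Real.rpow_le_one (by linarith [hx.2]) (by linarith [hx1.1]) hs0.le
  have hsplit : cauchyIntegralDeriv h w
      = (∫ t in Ioo (-1 : ℝ) 1, ((h t - h x : ℝ) : ℂ) / (t - w) ^ 2)
        + h x * (-(1 / (1 - w)) + 1 / (-1 - w)) := by
    rw [← integral_one_div_sub_sq hw0, ← integral_const_mul, cauchyIntegralDeriv, ← integral_add]
    · congr 1; ext t; push_cast; ring
    · exact integrable_div_sub_pow (f := fun t => ((h t - h x : ℝ) : ℂ))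
        (hh.sub (integrable_const _)).ofReal hw0 2
    · exact (integrable_div_sub_pow (f := fun _ => (1 : ℂ)) (integrable_const _) hw0 2).const_mul _
  have hsecond : ‖(h x : ℂ) * (-(1 / (1 - w)) + 1 / (-1 - w))‖ ≤ 2 * D * y ^ (s - 1) := by
    rw [mul_add]
    refine (norm_add_le _ _).trans ?_
    rw [norm_mul, norm_mul, norm_neg, norm_div, norm_div, norm_one, Complex.norm_real,
      Real.norm_eq_abs]
    have hn : y ≤ ‖1 - w‖ := by
      have := abs_im_le_norm_ofReal_sub 1 w
      rw [hwim, abs_of_pos hy.1] at this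
      simpa using this
    have hn2 : 1 - x ≤ ‖1 - w‖ := by
      have := (le_abs_self _).trans (Complex.abs_re_le_norm (1 - w))
      simpa [hwre] using this
    have hn3 : 1 ≤ ‖-1 - w‖ := by
      have := (neg_le_abs _).trans (Complex.abs_re_le_norm (-1 - w))
      simp only [Complex.sub_re, Complex.neg_re, Complex.one_re, hwre] at this
      linarith [hx1.1]
    have hn0 : 0 < ‖1 - w‖ := hy.1.trans_le hn
    have t1 : |h x| * (1 / ‖1 - w‖) ≤ D * y ^ (s - 1) := by
      calc |h x| * (1 / ‖1 - w‖) ≤ (D * ‖1 - w‖ ^ s) * (1 / ‖1 - w‖) := by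
            gcongr
            refine hhx.trans (mul_le_mul_of_nonneg_left ?_ hD)
            exact Real.rpow_le_rpow (by linarith [hx.2]) hn2 hs0.le
        _ = D * ‖1 - w‖ ^ (s - 1) := by
            rw [Real.rpow_sub_one hn0.ne']; ring
        _ ≤ D * y ^ (s - 1) := by
            refine mul_le_mul_of_nonneg_left ?_ hD
            exact Real.rpow_le_rpow_of_nonpos hy.1 hn (by linarith)
    have t2 : |h x| * (1 / ‖-1 - w‖) ≤ D * y ^ (s - 1) := by
      refine mul_le_mul hhx' ?_ (by positivity) hD
      exact le_trans (by rw [div_le_one (by linarith)]; exact hn3) hy1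
    linarith
  have hfirst : ‖∫ t in Ioo (-1 : ℝ) 1, ((h t - h x : ℝ) : ℂ) / (t - w) ^ 2‖
      ≤ D * (y ^ (s - 1) * A) + M := by
    have hb1 := ((integrable_rpow_sq_add_sq_shift (x := x) hs1 hy.1).const_mul D)
    have hb2 : IntegrableOn (fun t => (|h t| + D) * (d ^ 2)⁻¹) (Ioo (-1) 1) :=
      (hh.abs.add (integrable_const _)).mul_const _
    have hle : ‖∫ t in Ioo (-1 : ℝ) 1, ((h t - h x : ℝ) : ℂ) / (t - w) ^ 2‖
        ≤ ∫ t in Ioo (-1 : ℝ) 1, (D * ((t - x) ^ 2 + y ^ 2) ^ ((s - 2) / 2)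
          + (|h t| + D) * (d ^ 2)⁻¹) := by
      refine norm_integral_le_of_norm_le (hb1.integrableOn.add hb2) ?_
      filter_upwards [ae_restrict_mem measurableSet_Ioo] with t ht
      have hnsq : ‖(t : ℂ) - w‖ ^ 2 = (t - x) ^ 2 + y ^ 2 := by
        rw [← Complex.normSq_eq_norm_sq, Complex.normSq_apply]
        simp [hw]; ring
      rw [norm_div, norm_pow, Complex.norm_real, hnsq, Real.norm_eq_abs]
      have hpos : 0 < (t - x) ^ 2 + y ^ 2 := by have := hy.1; positivity
      have nn1 : 0 ≤ D * ((t - x) ^ 2 + y ^ 2) ^ ((s - 2) / 2) := by positivity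
      have nn2 : 0 ≤ (|h t| + D) * (d ^ 2)⁻¹ := by positivity
      by_cases htx : x₁ < t
      · have hh1 := hH t ⟨htx, ht.2.le⟩ x hx1
        have hh2 : |t - x| ^ s ≤ ((t - x) ^ 2 + y ^ 2) ^ (s / 2) := by
          rw [← Real.sqrt_sq_eq_abs, Real.sqrt_eq_rpow, ← Real.rpow_mul (sq_nonneg _)]
          rw [show 1 / 2 * s = s / 2 by ring]
          exact Real.rpow_le_rpow (sq_nonneg _) (by nlinarith [sq_nonneg y]) (by linarith)
        refine le_trans ?_ (le_add_of_nonneg_right nn2)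
        rw [div_le_iff₀ hpos]
        calc _ ≤ D * |t - x| ^ s := hh1
          _ ≤ D * ((t - x) ^ 2 + y ^ 2) ^ (s / 2) := mul_le_mul_of_nonneg_left hh2 hD
          _ = _ := by
            rw [show (s - 2) / 2 = s / 2 - 1 by ring, Real.rpow_sub_one hpos.ne']
            field_simp
      · refine le_trans ?_ (le_add_of_nonneg_left nn1)
        have hdt : d ≤ x - t := by
          simp only [hd]; linarith [hx.1, not_lt.1 htx]
        rw [div_eq_mul_inv]
        have e1 : |h t - h x| ≤ |h t| + D := (abs_sub _ _).trans (by linarith)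
        have e2 : d ^ 2 ≤ (t - x) ^ 2 + y ^ 2 := by nlinarith [sq_nonneg y]
        gcongr
    refine hle.trans ?_
    rw [integral_add hb1.integrableOn hb2, ← integral_rpow_sq_add_sq_shift (x := x) hy.1,
      ← integral_const_mul]
    refine add_le_add ?_ le_rfl
    exact setIntegral_le_integral hb1 (ae_of_all _ fun t => by positivity)
  rw [hsplit]
  refine (norm_add_le _ _).trans ?_
  have hMy : M ≤ M * y ^ (s - 1) := le_mul_of_one_le_right hM0 hy1
  calc _ ≤ (D * (y ^ (s - 1) * A) + M) + 2 * D * y ^ (s - 1) := add_le_add hfirst hsecond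
    _ ≤ _ := by linarith

end BoundaryValue

/-! ### Continuous boundary values of the Cauchy integral. -/

section BoundaryLimit

variable {h : ℝ → ℝ} {x₂ s B : ℝ}

/-- The boundary value of `cauchyIntegral h` from the upper half-plane, obtained by integrating the
derivative down a vertical segment. -/
noncomputable def cauchyBoundaryValue (h : ℝ → ℝ) (x : ℝ) : ℂ :=
  cauchyIntegral h (x + Complex.I)
    - Complex.I * ∫ t in (0 : ℝ)..1, cauchyIntegralDeriv h (x + t * Complex.I)

lemma intervalIntegrable_bound (hs0 : 0 < s) :
    IntervalIntegrable (fun t : ℝ => B * t ^ (s - 1)) volume 0 1 :=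
  (intervalIntegral.intervalIntegrable_rpow' (by linarith)).const_mul B

lemma continuousOn_cauchyIntegralDeriv_vertical (hh : IntegrableOn h (Ioo (-1) 1)) (x : ℝ) :
    ContinuousOn (fun t : ℝ => cauchyIntegralDeriv h (x + t * Complex.I)) (Ioi 0) :=
  (continuousOn_cauchyIntegralDeriv hh).comp (by fun_prop) fun t ht => by
    simpa using (mem_Ioi.1 ht).ne'

lemma aestronglyMeasurable_cauchyIntegralDeriv_vertical (hh : IntegrableOn h (Ioo (-1) 1)) (x : ℝ) :
    AEStronglyMeasurable (fun t : ℝ => cauchyIntegralDeriv h (x + t * Complex.I))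
      (volume.restrict (uIoc 0 1)) := by
  rw [uIoc_of_le zero_le_one]
  exact ((continuousOn_cauchyIntegralDeriv_vertical hh x).mono fun t ht => ht.1).aestronglyMeasurable
    measurableSet_Ioc

lemma intervalIntegrable_cauchyIntegralDeriv_vertical (hh : IntegrableOn h (Ioo (-1) 1)) (hs0 : 0 < s)
    {x : ℝ} (hB : ∀ y ∈ Ioc (0 : ℝ) 1,
      ‖cauchyIntegralDeriv h (x + y * Complex.I)‖ ≤ B * y ^ (s - 1)) :
    IntervalIntegrable (fun t : ℝ => cauchyIntegralDeriv h (x + t * Complex.I)) volume 0 1 := by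
  refine (intervalIntegrable_bound (B := B) hs0).mono_fun'
    (aestronglyMeasurable_cauchyIntegralDeriv_vertical hh x) ?_
  filter_upwards [ae_restrict_mem measurableSet_uIoc] with t ht
  rw [uIoc_of_le zero_le_one] at ht
  exact hB t ht

lemma cauchyIntegral_eq_sub_integral (hh : IntegrableOn h (Ioo (-1) 1)) {x y : ℝ}
    (hy : y ∈ Ioc (0 : ℝ) 1) :
    cauchyIntegral h (x + y * Complex.I) = cauchyIntegral h (x + Complex.I)
      - Complex.I * ∫ t in y..1, cauchyIntegralDeriv h (x + t * Complex.I) := by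
  have hpos : ∀ t ∈ uIcc y 1, 0 < t := fun t ht => by
    rw [uIcc_of_le hy.2] at ht
    exact hy.1.trans_le ht.1
  have hd : ∀ t ∈ uIcc y 1, HasDerivAt (fun t : ℝ => cauchyIntegral h (x + t * Complex.I))
      (cauchyIntegralDeriv h (x + t * Complex.I) * Complex.I) t := by
    intro t ht
    have h1 : HasDerivAt (fun t : ℂ => (x : ℂ) + t * Complex.I) Complex.I (t : ℂ) := by
      simpa using ((hasDerivAt_id (t : ℂ)).mul_const Complex.I).const_add (x : ℂ)
    have h2 := (hasDerivAt_cauchyIntegral hh (z := (x : ℂ) + t * Complex.I)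
      (by simpa using (hpos t ht).ne')).comp (t : ℂ) h1
    exact h2.comp_ofReal
  have hc : ContinuousOn (fun t : ℝ => cauchyIntegralDeriv h (x + t * Complex.I) * Complex.I)
      (uIcc y 1) :=
    ((continuousOn_cauchyIntegralDeriv_vertical hh x).mono hpos).mul continuousOn_const
  have := intervalIntegral.integral_eq_sub_of_hasDerivAt hd hc.intervalIntegrable
  rw [intervalIntegral.integral_mul_const] at this
  rw [mul_comm Complex.I, this]
  simp

lemma tendsto_cauchyIntegral_boundary (hh : IntegrableOn h (Ioo (-1) 1)) (hs0 : 0 < s) {x : ℝ}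
    (hB : ∀ y ∈ Ioc (0 : ℝ) 1, ‖cauchyIntegralDeriv h (x + y * Complex.I)‖ ≤ B * y ^ (s - 1)) :
    Tendsto (fun y : ℝ => cauchyIntegral h (x + y * Complex.I)) (𝓝[>] 0)
      (𝓝 (cauchyBoundaryValue h x)) := by
  have hI := intervalIntegrable_cauchyIntegralDeriv_vertical hh hs0 hB
  have hI' : IntegrableOn (fun t : ℝ => cauchyIntegralDeriv h (x + t * Complex.I)) (uIcc 0 1) := by
    rw [uIcc_of_le zero_le_one]
    exact (intervalIntegrable_iff_integrableOn_Icc_of_le zero_le_one).1 hI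
  have hc := intervalIntegral.continuousOn_primitive_interval_left hI' 0 left_mem_uIcc
  rw [uIcc_of_le zero_le_one] at hc
  have hle : 𝓝[>] (0 : ℝ) ≤ 𝓝[Icc 0 1] 0 := by
    rw [← nhdsWithin_Ioc_eq_nhdsGT (zero_lt_one)]
    exact nhdsWithin_mono _ Ioc_subset_Icc_self
  have h1 := ((hc.tendsto.mono_left hle).const_mul Complex.I).const_sub
    (cauchyIntegral h (x + Complex.I))
  refine h1.congr' ?_
  filter_upwards [Ioc_mem_nhdsGT (zero_lt_one' ℝ)] with y hy
  rw [cauchyIntegral_eq_sub_integral hh hy]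

/-- Integrating the derivative down from height `1` costs at most the finite integral of `B t^(s -
1)`; the bound is independent of `x` and `y`, as needed for domination on horizontal segments. -/
lemma norm_cauchyIntegral_le (hh : IntegrableOn h (Ioo (-1) 1)) (hs0 : 0 < s) (hB0 : 0 ≤ B) {x : ℝ}
    (hB : ∀ y ∈ Ioc (0 : ℝ) 1, ‖cauchyIntegralDeriv h (x + y * Complex.I)‖ ≤ B * y ^ (s - 1))
    {y : ℝ} (hy : y ∈ Ioc (0 : ℝ) 1) :
    ‖cauchyIntegral h (x + y * Complex.I)‖
      ≤ (∫ t in Ioo (-1 : ℝ) 1, |h t|) + ∫ t in (0 : ℝ)..1, B * t ^ (s - 1) := by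
  rw [cauchyIntegral_eq_sub_integral hh hy]
  refine (norm_sub_le _ _).trans (add_le_add ?_ ?_)
  · refine norm_integral_le_of_norm_le hh.abs (ae_of_all _ fun t => ?_)
    rw [norm_div, Complex.norm_real, Real.norm_eq_abs]
    refine div_le_self (abs_nonneg _) ?_
    have := abs_im_le_norm_ofReal_sub t (x + Complex.I)
    simpa using this
  · rw [norm_mul, Complex.norm_I, one_mul]
    have hb := intervalIntegrable_bound (B := B) hs0
    refine (intervalIntegral.norm_integral_le_of_norm_le hy.2 (ae_of_all _ fun t ht =>
      hB t ⟨hy.1.trans ht.1, ht.2⟩) (hb.mono_set ?_)).trans ?_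
    · rw [uIcc_of_le hy.2, uIcc_of_le zero_le_one]
      exact Icc_subset_Icc_left hy.1.le
    · refine intervalIntegral.integral_mono_interval hy.1.le hy.2 le_rfl ?_ hb
      filter_upwards [ae_restrict_mem measurableSet_Ioc] with t ht
      have := ht.1.le
      positivity

/-- The majorant `B t^(s - 1)` does not depend on `x`, so continuity includes the endpoint `1`,
where the tip limit is read off. -/
lemma continuousOn_cauchyBoundaryValue (hh : IntegrableOn h (Ioo (-1) 1)) (hs0 : 0 < s)
    (hB : ∀ x ∈ Icc x₂ 1, ∀ y ∈ Ioc (0 : ℝ) 1,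
      ‖cauchyIntegralDeriv h (x + y * Complex.I)‖ ≤ B * y ^ (s - 1)) :
    ContinuousOn (cauchyBoundaryValue h) (Icc x₂ 1) := by
  have hc1 : Continuous fun x : ℝ => cauchyIntegral h (x + Complex.I) :=
    continuous_iff_continuousAt.2 fun x =>
      ContinuousAt.comp (f := fun x : ℝ => (x : ℂ) + Complex.I)
        (hasDerivAt_cauchyIntegral hh (by simp)).continuousAt (by fun_prop)
  refine hc1.continuousOn.sub (continuousOn_const.mul fun x hx => ?_)
  refine intervalIntegral.continuousWithinAt_of_dominated_interval
    (bound := fun t => B * t ^ (s - 1)) ?_ ?_ (intervalIntegrable_bound hs0) ?_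
  · exact Eventually.of_forall fun y => aestronglyMeasurable_cauchyIntegralDeriv_vertical hh y
  · filter_upwards [self_mem_nhdsWithin] with y hy
    refine ae_of_all _ fun t ht => ?_
    rw [uIoc_of_le zero_le_one] at ht
    exact hB y hy t ht
  · refine ae_of_all _ fun t ht => ?_
    rw [uIoc_of_le zero_le_one] at ht
    have ho : IsOpen {z : ℂ | z.im ≠ 0} := isOpen_ne_fun Complex.continuous_im continuous_const
    have him : ((x : ℂ) + t * Complex.I).im ≠ 0 := by simpa using ht.1.ne'
    exact (ContinuousAt.comp (f := fun x : ℝ => (x : ℂ) + t * Complex.I)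
      ((continuousOn_cauchyIntegralDeriv hh).continuousAt (ho.mem_nhds him))
      (by fun_prop)).continuousWithinAt

end BoundaryLimit

/-! ### The opening near the tip -/

section Opening

variable {E ν : ℝ} {u p : ℝ → ℝ}

lemma im_div_sub_eq {a x y t : ℝ} :
    ((a : ℂ) / (t - (x + y * Complex.I))).im = a * (y / ((t - x) ^ 2 + y ^ 2)) := by
  rw [Complex.div_im, Complex.normSq_apply]
  simp
  ring

/-- The Poisson integral of a bounded continuous function converges to it. -/
lemma tendsto_im_integral_div_sub (hu : Continuous u) (hui : Integrable u) {B : ℝ}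
    (hB : ∀ x, ‖u x‖ ≤ B) (x : ℝ) :
    Tendsto (fun y : ℝ => (∫ t, (u t : ℂ) / (t - (x + y * Complex.I))).im) (𝓝[>] 0)
      (𝓝 (Real.pi * u x)) := by
  have hlim : Tendsto (fun y : ℝ => ∫ q : ℝ, u (x + y * q) * (1 + q ^ 2)⁻¹) (𝓝[>] 0)
      (𝓝 (∫ q : ℝ, u x * (1 + q ^ 2)⁻¹)) := by
    refine tendsto_integral_filter_of_dominated_convergence (fun q => B * (1 + q ^ 2)⁻¹) ?_ ?_
      (integrable_inv_one_add_sq.const_mul B) ?_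
    · refine Eventually.of_forall fun y => Continuous.aestronglyMeasurable ?_
      exact (hu.comp (by fun_prop)).mul (Continuous.inv₀ (by fun_prop) fun q => by positivity)
    · refine Eventually.of_forall fun y => ae_of_all _ fun q => ?_
      rw [norm_mul, norm_inv, Real.norm_of_nonneg (show (0 : ℝ) ≤ 1 + q ^ 2 by positivity)]
      exact mul_le_mul_of_nonneg_right (hB _) (by positivity)
    · refine ae_of_all _ fun q => Tendsto.mul_const _ ?_
      have : Continuous fun y : ℝ => u (x + y * q) := hu.comp (by fun_prop)
      simpa using (this.tendsto 0).mono_left nhdsWithin_le_nhds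
  rw [integral_const_mul, integral_univ_inv_one_add_sq, mul_comm] at hlim
  refine hlim.congr' ?_
  filter_upwards [self_mem_nhdsWithin] with y hy
  have hy0 := mem_Ioi.1 hy
  have him : ((x : ℂ) + y * Complex.I).im ≠ 0 := by simpa using hy0.ne'
  have h1 := integrable_div_sub (f := fun t => (u t : ℂ)) hui.ofReal him
  have h2 : (∫ t, (u t : ℂ) / (t - (x + y * Complex.I))).im
      = ∫ t, ((u t : ℂ) / (t - (x + y * Complex.I))).im :=
    (integral_im (𝕜 := ℂ) h1).symm
  rw [h2]
  simp_rw [im_div_sub_eq]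
  have h3 := Measure.integral_comp_mul_left
    (fun t => u (x + t) * (y / (t ^ 2 + y ^ 2))) y
  rw [abs_of_pos (inv_pos.2 hy0), smul_eq_mul] at h3
  have h4 := integral_add_left_eq_self (μ := volume)
    (fun t => u t * (y / ((t - x) ^ 2 + y ^ 2))) x
  simp only [add_sub_cancel_left] at h4
  rw [← h4]
  rw [eq_inv_mul_iff_mul_eq₀ hy0.ne', ← integral_const_mul] at h3
  rw [← h3]
  congr 1; ext q
  have : (1 + q ^ 2) ≠ 0 := by positivity
  field_simp
  ring

/-- The derivative of the opening `u` inside the fracture, in terms of the boundary value of the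
Cauchy integral of the weighted pressure. -/
noncomputable def openingSlope (c : ℝ) (h : ℝ → ℝ) (x : ℝ) : ℝ :=
  (cauchyBoundaryValue h x).re / (c * Real.pi * √(1 - x ^ 2))

lemma im_neg_div_tipRoot {c x : ℝ} (hc : c ≠ 0) (hx : x ∈ Ioo (-1 : ℝ) 1) (z : ℂ) :
    (-(1 / (c : ℂ)) * (z / tipRoot x)).im = z.re / (c * √(1 - x ^ 2)) := by
  have h1 : √(1 - x ^ 2) ≠ 0 := (Real.sqrt_pos.2 (by nlinarith [hx.1, hx.2])).ne'
  rw [tipRoot_ofReal_of_mem_Ioo hx]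
  have h1' : ((√(1 - x ^ 2) : ℝ) : ℂ) ≠ 0 := by exact_mod_cast h1
  have hc' : (c : ℂ) ≠ 0 := by exact_mod_cast hc
  have e : -(1 / (c : ℂ)) * (z / (√(1 - x ^ 2) * Complex.I))
      = ((1 / (c * √(1 - x ^ 2)) : ℝ) : ℂ) * (z * Complex.I) := by
    push_cast
    field_simp
    rw [Complex.I_sq]; ring
  rw [e, Complex.im_ofReal_mul]
  simp
  ring

end Opening

/-! ### Differentiability of the opening and its slope at the tip. -/

section OpeningSlope

variable {u h : ℝ → ℝ} {c x₂ s B : ℝ}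

/-- The fundamental theorem of calculus is applied at height `y` to the Cauchy integral of `u`, and
then `y → 0⁺`. The endpoint values converge by the Poisson integral, the integrand through `hkey`
and the boundary values of both factors. -/
lemma integral_openingSlope (hc : c ≠ 0) (hu : Continuous u) (hui : Integrable u) {Bu : ℝ}
    (hBu : ∀ x, ‖u x‖ ≤ Bu)
    (hkey : ∀ z : ℂ, z.im ≠ 0 →
      ∫ t, (u t : ℂ) / (t - z) ^ 2 = -(1 / (c : ℂ)) * (cauchyIntegral h z / tipRoot z))
    (hh : IntegrableOn h (Ioo (-1) 1)) (hs0 : 0 < s) (hB0 : 0 ≤ B) (hx₂ : 0 ≤ x₂)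
    (hB : ∀ x ∈ Icc x₂ 1, ∀ y ∈ Ioc (0 : ℝ) 1,
      ‖cauchyIntegralDeriv h (x + y * Complex.I)‖ ≤ B * y ^ (s - 1))
    {a b : ℝ} (ha : a ∈ Ioo x₂ 1) (hb : b ∈ Ioo x₂ 1) (hab : a ≤ b) :
    ∫ x in a..b, openingSlope c h x = u b - u a := by
  set U : ℂ → ℂ := fun z => ∫ t, (u t : ℂ) / (t - z) with hU
  set U' : ℂ → ℂ := fun z => ∫ t, (u t : ℂ) / (t - z) ^ 2 with hU'
  have hUd : ∀ z : ℂ, z.im ≠ 0 → HasDerivAt U (U' z) z := fun z hz =>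
    hasDerivAt_integral_div_sub (f := fun t => (u t : ℂ)) hui.ofReal hz
  have ho : IsOpen {z : ℂ | z.im ≠ 0} := isOpen_ne_fun Complex.continuous_im continuous_const
  have hU'c : ContinuousOn U' {z | z.im ≠ 0} := by
    have hd : DifferentiableOn ℂ U {z | z.im ≠ 0} := fun z hz =>
      (hUd z hz).differentiableAt.differentiableWithinAt
    exact (hd.deriv ho).continuousOn.congr fun z hz => (hUd z hz).deriv.symm
  have hcont : ∀ y : ℝ, 0 < y → Continuous fun x : ℝ => (U' (x + y * Complex.I)).im := by
    intro y hy
    refine Complex.continuous_im.comp (hU'c.comp_continuous (by fun_prop) fun x => ?_)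
    simpa using hy.ne'
  have hftc : ∀ y : ℝ, 0 < y → ∫ x in a..b, (U' (x + y * Complex.I)).im
      = (U (b + y * Complex.I)).im - (U (a + y * Complex.I)).im := by
    intro y hy
    refine intervalIntegral.integral_eq_sub_of_hasDerivAt
      (f := fun x : ℝ => (U (x + y * Complex.I)).im) (fun x _ => ?_)
      ((hcont y hy).intervalIntegrable _ _)
    have h1 : HasDerivAt (fun z : ℂ => U (z + y * Complex.I)) (U' (x + y * Complex.I)) (x : ℂ) :=
      (hUd _ (by simpa using hy.ne')).comp_add_const _ _
    exact Complex.imCLM.hasFDerivAt.comp_hasDerivAt x h1.comp_ofReal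
  have hL : Tendsto (fun y : ℝ => ∫ x in a..b, (U' (x + y * Complex.I)).im) (𝓝[>] 0)
      (𝓝 (Real.pi * u b - Real.pi * u a)) := by
    refine ((tendsto_im_integral_div_sub hu hui hBu b).sub
      (tendsto_im_integral_div_sub hu hui hBu a)).congr' ?_
    filter_upwards [self_mem_nhdsWithin] with y hy
    exact (hftc y hy).symm
  have hmem : ∀ x ∈ uIoc a b, x ∈ Ioo x₂ 1 := fun x hx => by
    rw [uIoc_of_le hab] at hx
    exact ⟨ha.1.trans hx.1, hx.2.trans_lt hb.2⟩
  set M := (∫ t in Ioo (-1 : ℝ) 1, |h t|) + ∫ t in (0 : ℝ)..1, B * t ^ (s - 1) with hM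
  have hR : Tendsto (fun y : ℝ => ∫ x in a..b, (U' (x + y * Complex.I)).im) (𝓝[>] 0)
      (𝓝 (∫ x in a..b, Real.pi * openingSlope c h x)) := by
    refine intervalIntegral.tendsto_integral_filter_of_dominated_convergence
      (fun x => ‖(1 / (c : ℂ))‖ * (M * tipWeight x)) ?_ ?_ ?_ ?_
    · filter_upwards [self_mem_nhdsWithin] with y hy
      exact (hcont y hy).aestronglyMeasurable
    · filter_upwards [Ioc_mem_nhdsGT (zero_lt_one' ℝ)] with y hy
      refine ae_of_all _ fun x hx => ?_
      have hx' := hmem x hx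
      have him : ((x : ℂ) + y * Complex.I).im ≠ 0 := by simpa using hy.1.ne'
      have hre : ((x : ℂ) + y * Complex.I).re = x := by simp
      refine (Complex.abs_im_le_norm _).trans ?_
      simp only [hU']
      rw [hkey _ him, norm_mul, norm_neg]
      have e1 := norm_cauchyIntegral_le hh hs0 hB0 (hB x ⟨hx'.1.le, hx'.2.le⟩) hy
      have e2 := inv_norm_tipRoot_le (z := (x : ℂ) + y * Complex.I)
        (by rw [hre]; exact hx'.2.ne) (by rw [hre]; linarith [hx'.1])
      rw [hre] at e2
      refine mul_le_mul_of_nonneg_left ?_ (norm_nonneg _)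
      rw [norm_div, div_eq_mul_inv]
      exact mul_le_mul e1 e2 (by positivity) ((norm_nonneg _).trans e1)
    · refine IntervalIntegrable.const_mul (IntervalIntegrable.const_mul ?_ _) _
      rw [intervalIntegrable_iff_integrableOn_Icc_of_le hab]
      exact (integrableOn_tipWeight 1).mono_set
        (Icc_subset_Icc (by linarith [ha.1]) hb.2.le)
    · refine ae_of_all _ fun x hx => ?_
      have hx' := hmem x hx
      have hxI : x ∈ Ioo (-1 : ℝ) 1 := ⟨by linarith [hx'.1], hx'.2⟩
      have h1 := tendsto_cauchyIntegral_boundary hh hs0 (hB x ⟨hx'.1.le, hx'.2.le⟩)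
      have h2 := (h1.div (tendsto_tipRoot_add_mul_I x)
        (tipRoot_ofReal_ne_zero hx'.2.ne (by linarith [hx'.1]))).const_mul (-(1 / (c : ℂ)))
      have h3 := (Complex.continuous_im.tendsto _).comp h2
      have e : (-(1 / (c : ℂ)) * (cauchyBoundaryValue h x / tipRoot x)).im
          = Real.pi * openingSlope c h x := by
        rw [im_neg_div_tipRoot hc hxI, openingSlope]
        have := Real.pi_ne_zero
        field_simp
      rw [e] at h3
      refine h3.congr' ?_
      filter_upwards [self_mem_nhdsWithin] with y hy
      simp only [hU', Function.comp]
      rw [hkey _ (by simpa using (mem_Ioi.1 hy).ne')]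
      rfl
  have := tendsto_nhds_unique hR hL
  rw [intervalIntegral.integral_const_mul, ← mul_sub] at this
  exact mul_left_cancel₀ Real.pi_ne_zero this

lemma continuousOn_openingSlope (hc : c ≠ 0) (hx₂ : 0 ≤ x₂)
    (hF : ContinuousOn (cauchyBoundaryValue h) (Icc x₂ 1)) :
    ContinuousOn (openingSlope c h) (Ioo x₂ 1) := by
  refine ContinuousOn.div ((Complex.continuous_re.comp_continuousOn hF).mono Ioo_subset_Icc_self)
    (by fun_prop) fun x hx => ?_
  have : √(1 - x ^ 2) ≠ 0 := (Real.sqrt_pos.2 (by nlinarith [hx.1, hx.2])).ne'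
  exact mul_ne_zero (mul_ne_zero hc Real.pi_ne_zero) this

lemma hasDerivAt_of_integral_eq_sub {f g : ℝ → ℝ} {a b : ℝ} (hg : ContinuousOn g (Ioo a b))
    (hint : ∀ x ∈ Ioo a b, ∀ y ∈ Ioo a b, x ≤ y → ∫ t in x..y, g t = f y - f x) {x : ℝ}
    (hx : x ∈ Ioo a b) : HasDerivAt f (g x) x := by
  -- A base point strictly left of `x`: the integral identity is then needed only in its given
  -- order, on both sides of `x`.
  set m := (a + x) / 2 with hm
  have hm1 : a < m := by simp only [hm]; linarith [hx.1]
  have hm2 : m < x := by simp only [hm]; linarith [hx.1]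
  have hmI : m ∈ Ioo a b := ⟨hm1, hm2.trans hx.2⟩
  have hsub : uIcc m x ⊆ Ioo a b := by
    rw [uIcc_of_le hm2.le]
    exact fun t ht => ⟨hm1.trans_le ht.1, ht.2.trans_lt hx.2⟩
  have hd := intervalIntegral.integral_hasDerivAt_right (a := m) (b := x)
    (hg.mono hsub).intervalIntegrable
    (hg.stronglyMeasurableAtFilter isOpen_Ioo x hx) (hg.continuousAt (isOpen_Ioo.mem_nhds hx))
  have hd2 := hd.const_add (f m)
  refine hd2.congr_of_eventuallyEq ?_
  filter_upwards [Ioo_mem_nhds hm2 hx.2] with y hy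
  rw [hint m hmI y ⟨hm1.trans hy.1, hy.2⟩ hy.1.le]
  ring

end OpeningSlope

lemma opening_slope_at_tip {E ν : ℝ} {u p : ℝ → ℝ} (hE : 0 < E) (hν₁ : -1 < ν) (hν₂ : ν < 1)
    (hu : Continuous u) (hu0 : ∀ x, 1 ≤ |x| → u x = 0) (hp : PressureLaw E ν u p)
    (hp_int : IntegrableOn (fun z => √(1 + z) / √(1 - z) * p z) (Ioo (-1) 1))
    {x₀ : ℝ} (hx₀ : x₀ < 1) {C r : ℝ≥0} (hr : 0 < r)
    (hH : HolderOnWith C r (fun z => √(1 - z) * p z) (Ioo x₀ 1)) :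
    (∀ᶠ x in 𝓝[<] 1, DifferentiableAt ℝ u x) ∧
      Tendsto (fun x => deriv u x * √(1 - x)) (𝓝[<] 1)
        (𝓝 (-(4 * (1 - ν ^ 2) / (Real.pi * √2 * E)) *
          ∫ z in Ioo (-1 : ℝ) 1, √(1 + z) / √(1 - z) * p z)) := by
  have hν : 0 < 1 - ν ^ 2 := by nlinarith
  set c := E / (4 * (1 - ν ^ 2)) with hcd
  have hc : c ≠ 0 := (by positivity : 0 < c).ne'
  have hcs : HasCompactSupport u := HasCompactSupport.intro
    (isCompact_Icc (a := -1) (b := 1)) fun x hx => hu0 x (by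
      by_contra h; exact hx (abs_le.1 (not_le.1 h).le))
  have hui : Integrable u := hu.integrable_of_hasCompactSupport hcs
  obtain ⟨Bu, hBu⟩ := hu.bounded_above_of_compact_support hcs
  set h : ℝ → ℝ := fun t => √(1 - t ^ 2) * p t with hhd
  have hh : IntegrableOn h (Ioo (-1) 1) := integrableOn_sqrt_mul_pressure hp_int
  have htip : h 1 = 0 := by simp [hhd]
  obtain ⟨x₁, s, D, h0, h1, hs0, hs1, hD, hHol⟩ := exists_holder_sqrt_mul_pressure hx₀ hr hH hp_int
  obtain ⟨B, hB0, hB⟩ := exists_norm_cauchyIntegralDeriv_le hh h0 h1 hs0 hs1 hD hHol htip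
  set x₂ := (x₁ + 1) / 2 with hx₂d
  have hx₂ : 0 ≤ x₂ := by simp only [hx₂d]; linarith
  have hx₂1 : x₂ < 1 := by simp only [hx₂d]; linarith
  have hkey : ∀ z : ℂ, z.im ≠ 0 →
      ∫ t, (u t : ℂ) / (t - z) ^ 2 = -(1 / (c : ℂ)) * (cauchyIntegral h z / tipRoot z) := by
    intro z hz
    have e : cauchyIntegral h z = -(c : ℂ) * tipRoot z * ∫ t, (u t : ℂ) / (t - z) ^ 2 :=
      integral_pressure_div_sub hp hu hu0 hp_int hz
    have hs := tipRoot_ne_zero hz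
    have hc' : (c : ℂ) ≠ 0 := by exact_mod_cast hc
    rw [e]
    field_simp
  have hF := continuousOn_cauchyBoundaryValue hh hs0 hB
  have hder : ∀ x ∈ Ioo x₂ 1, HasDerivAt u (openingSlope c h x) x := fun x hx =>
    hasDerivAt_of_integral_eq_sub (continuousOn_openingSlope hc hx₂ hF)
      (fun a ha b hb hab =>
        integral_openingSlope hc hu hui hBu hkey hh hs0 hB0 hx₂ hB ha hb hab) hx
  have hnear : Ioo x₂ 1 ∈ 𝓝[<] (1 : ℝ) := Ioo_mem_nhdsLT hx₂1
  refine ⟨?_, ?_⟩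
  · filter_upwards [hnear] with x hx
    exact (hder x hx).differentiableAt
  -- At the tip the vertical limit is computed a second time, by dominated convergence: `h t / (t -
  -- 1)` is integrable by `hp_int`, so no principal value or jump term arises.
  have hF1 : cauchyBoundaryValue h 1
      = ((-∫ z in Ioo (-1 : ℝ) 1, √(1 + z) / √(1 - z) * p z : ℝ) : ℂ) := by
    have hval : ∀ t ∈ Ioo (-1 : ℝ) 1, (h t : ℂ) / ((t : ℂ) - (1 : ℝ)) ^ 1
        = ((-(√(1 + t) / √(1 - t) * p t) : ℝ) : ℂ) := by
      intro t ht
      have h2 : (1 - t : ℝ) ≠ 0 := by linarith [ht.2]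
      have h3 : (t : ℂ) - (1 : ℝ) = ((-(1 - t) : ℝ) : ℂ) := by push_cast; ring
      rw [pow_one, h3, ← Complex.ofReal_div]
      congr 1
      simp only [hhd]
      rw [sqrt_one_sub_sq ht]
      field_simp
    have hi : Integrable (fun t => (h t : ℂ) / ((t : ℂ) - (1 : ℝ)) ^ 1)
        (volume.restrict (Ioo (-1 : ℝ) 1)) := by
      refine Integrable.congr (f := fun t => ((-(√(1 + t) / √(1 - t) * p t) : ℝ) : ℂ))
        (Integrable.ofReal (Integrable.neg hp_int)) ?_
      filter_upwards [ae_restrict_mem measurableSet_Ioo] with t ht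
      exact (hval t ht).symm
    have hne : ∀ᵐ t ∂(volume.restrict (Ioo (-1 : ℝ) 1)), t ≠ 1 := by
      filter_upwards [ae_restrict_mem measurableSet_Ioo] with t ht using ht.2.ne
    have l1 := tendsto_integral_div_sub_pow (f := fun t => (h t : ℂ))
      hh.ofReal.aestronglyMeasurable hi hne
    have l2 := tendsto_cauchyIntegral_boundary hh hs0 (hB 1 ⟨hx₂1.le, le_rfl⟩)
    have l3 : Tendsto (fun y : ℝ => cauchyIntegral h ((1 : ℝ) + y * Complex.I)) (𝓝[>] 0)
        (𝓝 (∫ t in Ioo (-1 : ℝ) 1, (h t : ℂ) / ((t : ℂ) - (1 : ℝ)) ^ 1)) := by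
      refine l1.congr fun y => ?_
      simp_rw [pow_one]
      rfl
    rw [tendsto_nhds_unique l2 l3, setIntegral_congr_fun measurableSet_Ioo hval,
      integral_complex_ofReal, integral_neg]
  have hlimF : Tendsto (fun x => (cauchyBoundaryValue h x).re) (𝓝[<] 1)
      (𝓝 (-∫ z in Ioo (-1 : ℝ) 1, √(1 + z) / √(1 - z) * p z)) := by
    have hc1 := (hF 1 ⟨hx₂1.le, le_rfl⟩).tendsto
    have hle : 𝓝[<] (1 : ℝ) ≤ 𝓝[Icc x₂ 1] 1 := by
      rw [← nhdsWithin_Ioo_eq_nhdsLT hx₂1]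
      exact nhdsWithin_mono _ Ioo_subset_Icc_self
    have := (Complex.continuous_re.tendsto _).comp (hc1.mono_left hle)
    rwa [hF1, Complex.ofReal_re] at this
  have hlimS : Tendsto (fun x : ℝ => 1 / (c * Real.pi * √(1 + x))) (𝓝[<] 1)
      (𝓝 (1 / (c * Real.pi * √2))) := by
    have hc1 : ContinuousAt (fun x : ℝ => 1 / (c * Real.pi * √(1 + x))) 1 :=
      ContinuousAt.div (by fun_prop) (by fun_prop)
        (mul_ne_zero (mul_ne_zero hc Real.pi_ne_zero) (by norm_num))
    have h2 := hc1.tendsto.mono_left (nhdsWithin_le_nhds (s := Iio 1))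
    rwa [show (1 : ℝ) + 1 = 2 by norm_num] at h2
  have hfin := hlimS.mul hlimF
  have e : -(4 * (1 - ν ^ 2) / (Real.pi * √2 * E)) *
      ∫ z in Ioo (-1 : ℝ) 1, √(1 + z) / √(1 - z) * p z
      = 1 / (c * Real.pi * √2) * -∫ z in Ioo (-1 : ℝ) 1, √(1 + z) / √(1 - z) * p z := by
    have h2 : √2 ≠ 0 := by norm_num
    rw [hcd]
    field_simp
  rw [e]
  refine hfin.congr' ?_
  filter_upwards [hnear] with x hx
  have hx0 : 0 < x := hx₂.trans_lt hx.1
  have n1 : √(1 - x) ≠ 0 := (Real.sqrt_pos.2 (by linarith [hx.2])).ne'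
  have n2 : √(1 + x) ≠ 0 := (Real.sqrt_pos.2 (by linarith)).ne'
  have n3 := Real.pi_ne_zero
  rw [(hder x hx).deriv, openingSlope, show 1 - x ^ 2 = (1 - x) * (1 + x) by ring,
    Real.sqrt_mul (by linarith [hx.2])]
  field_simp

theorem lemma1p2 (E ν : ℝ) (hE : 0 < E) (hν₁ : -1 < ν) (hν₂ : ν < 1) (u p : ℝ → ℝ)
    (hu : Continuous u) (hu_nonneg : ∀ x, 0 ≤ u x) (hu_pos : {x | 0 < u x} = Ioo (-1) 1)
    (hp : PressureLaw E ν u p) (hp_cont : ContinuousOn p (Ioi 1))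
    (hp_int : IntegrableOn (fun z => √(1 + z) / √(1 - z) * p z) (Ioo (-1) 1)) :
    Tendsto (fun x => -√(x - 1) * p x) (𝓝[>] 1)
      (𝓝 (1 / (Real.pi * √2) * ∫ z in (-1 : ℝ)..1, √(1 + z) / √(1 - z) * p z)) ∧
    ((∃ x₀ < (1 : ℝ), ∃ C r : ℝ≥0, 0 < r ∧
        HolderOnWith C r (fun z => √(1 - z) * p z) (Ioo x₀ 1)) →
      (∀ᶠ x in 𝓝[<] 1, DifferentiableAt ℝ u x) ∧
      Tendsto (fun x => deriv u x * √(1 - x)) (𝓝[<] 1)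
        (𝓝 (-(4 * (1 - ν ^ 2) / (Real.pi * √2 * E)) *
          ∫ z in (-1 : ℝ)..1, √(1 + z) / √(1 - z) * p z))) := by
  have hu0 : ∀ x, 1 ≤ |x| → u x = 0 := by
    intro x hx
    refine le_antisymm (not_lt.1 fun h => ?_) (hu_nonneg x)
    have hmem : x ∈ Ioo (-1 : ℝ) 1 := hu_pos ▸ h
    exact absurd (abs_lt.2 hmem) (not_lt.2 hx)
  rw [intervalIntegral.integral_of_le (by norm_num), integral_Ioc_eq_integral_Ioo]
  refine ⟨tendsto_sqrt_mul_pressure hp hu hu0 hp_cont hp_int, ?_⟩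
  rintro ⟨x₀, hx₀, C, r, hr, hH⟩
  exact opening_slope_at_tip hE hν₁ hν₂ hu hu0 hp hp_int hx₀ hr hH
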